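/- **Setting.** Let $d\in\{2,3\}$ and let $\Omega\subset\mathbb R^d$ be a bounded open set with polyhedral Lipschitz boundary, subdivided into disjoint bounded open sets $\Omega_S$ and $\Omega_D$, also with polyhedral Lipschitz boundaries, by an interface $\Sigma$; that is, $\Omega=\Omega_S\cup\Sigma\cup\Omega_D$ with $\Sigma=\Omega\cap\partial\Omega_S\cap\partial\Omega_D$. Put $\Gamma_S=\partial\Omega_S\setminus\Sigma$, $\Gamma_D=\partial\Omega_D\setminus\Sigma$, and let $\nu$ be the unit normal on $\Sigma$ pointing from $\Omega_S$ to $\Omega_D$. Let $\mathbf H^1_S(\Omega_S)$ be the space of $\mathbf u\in H^1(\Omega_S)^d$ with $\mathbf u=0$ on $\Gamma_S$, let $\mathbf H_D(\mathrm{div},\Omega_D)$ be the space of $\mathbf u\in\mathbf H(\mathrm{div},\Omega_D)$ with $\mathbf u\cdot\nu=0$ on $\Gamma_D$, and let $L^2_0$ denote the square integrable functions with zero integral. For each value of a discretization parameter $h$ let finite dimensional subspaces $$\mathbf H^h(\Omega_S)\subset H^1(\Omega_S)^d,\quad \mathbf H^h(\Omega_D)\subset\mathbf H(\mathrm{div},\Omega_D),\quad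 L_0^h(\Omega_S)\subset L_0^2(\Omega_S),\quad L^h_0(\Omega_D)\subset L^2_0(\Omega_D)$$ be given, for example spaces of piecewise polynomials on triangulations. Put $L^h(\Omega_D)=L^h_0(\Omega_D)\oplus\mathbb P_0(\Omega_D)$ and $$\mathbf H^h_0(\Omega_S)=\mathbf H^h(\Omega_S)\cap H^1_0(\Omega_S)^d,\qquad \mathbf H^h_0(\Omega_D)=\mathbf H^h(\Omega_D)\cap\mathbf H_0(\mathrm{div},\Omega_D),$$ $$\mathbf H^h_S(\Omega_S)=\mathbf H^h(\Omega_S)\cap\mathbf H^1_S(\Omega_S),\qquad \mathbf H^h_D(\Omega_D)=\mathbf H^h(\Omega_D)\cap\mathbf H_D(\mathrm{div},\Omega_D).$$ Let $\Phi^h_D$ be the space of those $\varphi\in L^2(\Sigma)$ with $\varphi=\mathbf u\cdot\nu$ on $\Sigma$ for some $\mathbf u\in\mathbf H_D^h(\Omega_D)$, and let $R^h_D$ be the $L^2(\Sigma)$-orthogonal projection onto $\Phi^h_D$. Define $$\mathbb X^h=\{(\mathbf u_S,\mathbf u_D)\in\mathbf H^h_S(\Omega_S)\times\mathbf H^h_D(\Omega_D):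 \mathbf u_D\cdot\nu=R^h_D(\mathbf u_S\cdot\nu)\text{ on }\Sigma\},\qquad \mathbb Q^h=L^h_0(\Omega_S)\times L^h_0(\Omega_D)\times\mathbb R,$$ with norms $\|\mathbf u\|_{\mathbb X}=(\|\mathbf u_S\|_{H^1(\Omega_S)}^2+\|\mathbf u_D\|^2_{\mathbf H(\mathrm{div},\Omega_D)})^{1/2}$ and $\|(q_S,q_D,\delta)\|_{\mathbb Q}=(\|q_S\|^2_{L^2(\Omega_S)}+\|q_D\|^2_{L^2(\Omega_D)}+\delta^2)^{1/2}$, and $$b(\mathbf u,(q,\delta))=(\mathrm{div}\,\mathbf u_S,q_S)_{\Omega_S}+(\mathrm{div}\,\mathbf u_D,q_D)_{\Omega_D}+\delta\,\langle\mathbf u_S\cdot\nu,1\rangle_\Sigma .$$ **Hypothesis 1.** There are $\beta_S,\beta_D>0$ such that for all $h$ $$\sup_{0\ne\mathbf u\in\mathbf H^h_0(\Omega_S)}\frac{(\mathrm{div}\,\mathbf u,q)_{\Omega_S}}{\|\mathbf u\|_{H^1(\Omega_S)}}\ge\beta_S\|q\|_{L^2(\Omega_S)}\ \ \forall q\in L_0^h(\Omega_S),\qquad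 \sup_{0\ne\mathbf u\in\mathbf H^h_0(\Omega_D)}\frac{(\mathrm{div}\,\mathbf u,q)_{\Omega_D}}{\|\mathbf u\|_{\mathbf H(\mathrm{div},\Omega_D)}}\ge\beta_D\|q\|_{L^2(\Omega_D)}\ \ \forall q\in L_0^h(\Omega_D),$$ and $\mathrm{div}\,\mathbf H^h(\Omega_D)\subset L^h(\Omega_D)$. (A supremum over the empty set is read as $0$, here and below.) **Hypothesis 2.** (a) There are $\beta_0,\beta_1>0$ such that for every $h$ there is $\mathbf v_h\in\mathbf H^h_S(\Omega_S)$ with $\langle\mathbf v_h\cdot\nu,1\rangle_\Sigma\ge\beta_0$ and $\|\mathbf v_h\|_{H^1(\Omega_S)}\le\beta_1$. (b) There are a constant $C>0$ and, for every $h$, a linear map $\mathbf L^h:\Phi^h_D\to\mathbf H^h_D(\Omega_D)$ with $(\mathbf L^h\varphi)\cdot\nu=\varphi$ on $\Sigma$ and $\|\mathbf L^h\varphi\|_{\mathbf H(\mathrm{div},\Omega_D)}\le C\|\varphi\|_{H^{-1/2}_{00}(\Sigma)}$ for all $\varphi\in\Phi^h_D$. Here $H^{1/2}_{00}(\Sigma)$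 is the space of functions on $\Sigma$ whose extension by zero to $\partial\Omega_D$ is the trace of a function in $H^1(\Omega_D)$, with the corresponding quotient norm, and $H^{-1/2}_{00}(\Sigma)$ is its dual with pivot space $L^2(\Sigma)$. **Proposition.** Hypotheses 1 and 2 imply that $b$ satisfies a uniform inf-sup condition for the pair $\{\mathbb X^h,\mathbb Q^h\}$: there is $\beta>0$, independent of $h$, such that $$\sup_{0\neq\mathbf u\in\mathbb X^h}\frac{b(\mathbf u,(q,\delta))}{\|\mathbf u\|_{\mathbb X}}\ \ge\ \beta\,\|(q,\delta)\|_{\mathbb Q}\qquad\forall\,(q,\delta)\in\mathbb Q^h,\ \forall h .$$ -/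

import Mathlib

open MeasureTheory Filter Topology
open scoped ContDiff RealInnerProductSpace

noncomputable section

namespace StokesDarcy

/-- Euclidean space `ℝ^d`. -/
abbrev E (d : ℕ) : Type := EuclideanSpace ℝ (Fin d)

variable {d : ℕ}
variable {F : Type} [NormedAddCommGroup F] [NormedSpace ℝ F]

/-- The `j`-th coordinate vector of `ℝ^d`. -/
def coordVec (j : Fin d) : E d := EuclideanSpace.single j (1 : ℝ)

/-! ## Lebesgue spaces -/

/-- `L²(O; F)` with respect to Lebesgue measure. -/
abbrev L2 (O : Set (E d)) (F : Type) [NormedAddCommGroup F] : Type :=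
  Lp F 2 ((volume : Measure (E d)).restrict O)

/-- Surface measure on `ℝ^d`: the `(d-1)`-dimensional Hausdorff measure, normalised so that it
agrees with Lebesgue measure on hyperplanes. -/
def surf (d : ℕ) : Measure (E d) := Measure.euclideanHausdorffMeasure (d - 1)

/-- `L²(S; F)` with respect to surface measure, for a piece of surface `S`. -/
abbrev L2Surf (S : Set (E d)) (F : Type) [NormedAddCommGroup F] : Type :=
  Lp F 2 ((surf d).restrict S)

/-! ## Weak derivatives and the spaces `H¹` and `H(div)` -/

/-- Smooth real functions on `ℝ^d` with compact support contained in `O`. -/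
def IsTest (O : Set (E d)) (φ : E d → ℝ) : Prop :=
  ContDiff ℝ ∞ φ ∧ HasCompactSupport φ ∧ tsupport φ ⊆ O

/-- `g` is the weak partial derivative `∂_j u` in `O`. -/
def HasWeakPartial (O : Set (E d)) (j : Fin d) (u g : L2 O F) : Prop :=
  ∀ φ : E d → ℝ, IsTest O φ →
    ∫ x in O, fderiv ℝ φ x (coordVec j) • u x = - ∫ x in O, φ x • g x

/-- `g` is the weak divergence of the vector field `u` in `O`
(here `fderiv ℝ φ x (u x) = ∇φ(x) · u(x)`). -/
def HasWeakDiv (O : Set (E d)) (u : L2 O (E d)) (g : L2 O ℝ) : Prop :=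
  ∀ φ : E d → ℝ, IsTest O φ →
    ∫ x in O, fderiv ℝ φ x (u x) = - ∫ x in O, φ x • g x

open Classical in
/-- The weak partial derivative `∂_j u` (zero if it does not exist in `L²`). -/
def weakPartial (O : Set (E d)) (j : Fin d) (u : L2 O F) : L2 O F :=
  if h : ∃ g, HasWeakPartial O j u g then h.choose else 0

open Classical in
/-- The weak divergence of `u` (zero if it does not exist in `L²`). -/
def weakDiv (O : Set (E d)) (u : L2 O (E d)) : L2 O ℝ :=
  if h : ∃ g, HasWeakDiv O u g then h.choose else 0

theorem integrable_test_smul {O : Set (E d)} {φ : E d → ℝ} (hφ : IsTest O φ) (g : L2 O F) :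
    Integrable (fun x => φ x • g x) ((volume : Measure (E d)).restrict O) := by
  have h1 : MemLp φ 2 ((volume : Measure (E d)).restrict O) :=
    (hφ.1.continuous.memLp_of_hasCompactSupport hφ.2.1).restrict O
  exact memLp_one_iff_integrable.mp ((Lp.memLp g).smul h1)

theorem integrable_fderiv_smul {O : Set (E d)} {φ : E d → ℝ} (hφ : IsTest O φ) (j : Fin d)
    (g : L2 O F) :
    Integrable (fun x => fderiv ℝ φ x (coordVec j) • g x)
      ((volume : Measure (E d)).restrict O) := by
  have hc : Continuous fun x => fderiv ℝ φ x (coordVec j) :=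
    (hφ.1.continuous_fderiv (by simp)).clm_apply continuous_const
  have hs : HasCompactSupport fun x => fderiv ℝ φ x (coordVec j) :=
    hφ.2.1.fderiv_apply (𝕜 := ℝ) (coordVec j)
  have h1 : MemLp (fun x => fderiv ℝ φ x (coordVec j)) 2
      ((volume : Measure (E d)).restrict O) :=
    (hc.memLp_of_hasCompactSupport hs).restrict O
  exact memLp_one_iff_integrable.mp ((Lp.memLp g).smul h1)

theorem fderiv_apply_eq_sum (φ : E d → ℝ) (x v : E d) :
    fderiv ℝ φ x v = ∑ j, fderiv ℝ φ x (coordVec j) • v j := by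
  have hv : v = ∑ j, v j • coordVec j := by
    have := (EuclideanSpace.basisFun (Fin d) ℝ).sum_repr v
    simpa [coordVec] using this.symm
  conv_lhs => rw [hv]
  rw [map_sum]
  refine Finset.sum_congr rfl fun j _ => ?_
  rw [map_smul, smul_eq_mul, smul_eq_mul, mul_comm]

theorem integrable_fderiv_apply {O : Set (E d)} {φ : E d → ℝ} (hφ : IsTest O φ)
    (u : L2 O (E d)) :
    Integrable (fun x => fderiv ℝ φ x (u x)) ((volume : Measure (E d)).restrict O) := by
  have hc : Continuous (fderiv ℝ φ) := hφ.1.continuous_fderiv (by simp)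
  have h1 : MemLp (fderiv ℝ φ) 2 ((volume : Measure (E d)).restrict O) :=
    (hc.memLp_of_hasCompactSupport (hφ.2.1.fderiv (𝕜 := ℝ))).restrict O
  have h2 := (Lp.memLp u).norm.integrable_mul h1.norm
  refine h2.mono' ?_ (Eventually.of_forall fun x => ?_)
  · have := (Lp.aestronglyMeasurable u)
    exact (ContinuousLinearMap.apply ℝ ℝ : E d →L[ℝ] (E d →L[ℝ] ℝ) →L[ℝ] ℝ).aestronglyMeasurable_comp₂
      this h1.1
  · simpa [mul_comm] using (fderiv ℝ φ x).le_opNorm (u x)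

/-- Uniqueness of the weak divergence on open sets. -/
theorem HasWeakDiv.unique {O : Set (E d)} (hO : IsOpen O) {u : L2 O (E d)} {g g' : L2 O ℝ}
    (h : HasWeakDiv O u g) (h' : HasWeakDiv O u g') : g = g' := by
  have hloc : LocallyIntegrableOn (fun x => g x - g' x) O (volume : Measure (E d)) := by
    have h2 : MemLp (fun x => g x - g' x) 2 ((volume : Measure (E d)).restrict O) :=
      (Lp.memLp g).sub (Lp.memLp g')
    have h3 := h2.locallyIntegrable (by norm_num)
    rw [locallyIntegrableOn_iff hO.isLocallyClosed]
    intro k hk hkc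
    have := h3.integrableOn_isCompact hkc
    rwa [IntegrableOn, Measure.restrict_restrict hkc.measurableSet,
      Set.inter_eq_left.mpr hk] at this
  have key := hO.ae_eq_zero_of_integral_contDiff_smul_eq_zero hloc (by
    intro φ h1 h2 h3
    have ht : IsTest O φ := ⟨h1, h2, h3⟩
    have e := (h φ ht).symm.trans (h' φ ht)
    have e2 : ∫ x in O, φ x • (g x - g' x) = 0 := by
      simp only [smul_sub]
      rw [integral_sub (integrable_test_smul ht g) (integrable_test_smul ht g')]
      linarith
    rw [← e2, setIntegral_eq_integral_of_forall_compl_eq_zero]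
    intro x hx
    have : φ x = 0 := image_eq_zero_of_notMem_tsupport fun hx' => hx (h3 hx')
    simp [this])
  refine Lp.ext ?_
  have := (ae_restrict_iff' hO.measurableSet).mpr key
  filter_upwards [this] with x hx
  linarith

theorem weakDiv_eq {O : Set (E d)} (hO : IsOpen O) {u : L2 O (E d)} {g : L2 O ℝ}
    (h : HasWeakDiv O u g) : weakDiv O u = g := by
  have hex : ∃ g, HasWeakDiv O u g := ⟨g, h⟩
  rw [weakDiv, dif_pos hex]
  exact hex.choose_spec.unique hO h

theorem HasWeakPartial.add {O : Set (E d)} {j : Fin d} {u v g k : L2 O F}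
    (h : HasWeakPartial O j u g) (h' : HasWeakPartial O j v k) :
    HasWeakPartial O j (u + v) (g + k) := by
  intro φ hφ
  have e1 : ∫ x in O, fderiv ℝ φ x (coordVec j) • (u + v : L2 O F) x
      = ∫ x in O, (fderiv ℝ φ x (coordVec j) • u x + fderiv ℝ φ x (coordVec j) • v x) := by
    refine integral_congr_ae ?_
    filter_upwards [Lp.coeFn_add u v] with x hx
    simp only [hx, Pi.add_apply, smul_add]
  have e2 : ∫ x in O, φ x • (g + k : L2 O F) x
      = ∫ x in O, (φ x • g x + φ x • k x) := by
    refine integral_congr_ae ?_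
    filter_upwards [Lp.coeFn_add g k] with x hx
    simp only [hx, Pi.add_apply, smul_add]
  rw [e1, e2, integral_add (integrable_fderiv_smul hφ j u) (integrable_fderiv_smul hφ j v),
    integral_add (integrable_test_smul hφ g) (integrable_test_smul hφ k), h φ hφ, h' φ hφ]
  abel

theorem HasWeakPartial.smul {O : Set (E d)} {j : Fin d} {u g : L2 O F} (c : ℝ)
    (h : HasWeakPartial O j u g) : HasWeakPartial O j (c • u) (c • g) := by
  intro φ hφ
  have e1 : ∫ x in O, fderiv ℝ φ x (coordVec j) • (c • u : L2 O F) x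
      = ∫ x in O, c • (fderiv ℝ φ x (coordVec j) • u x) := by
    refine integral_congr_ae ?_
    filter_upwards [Lp.coeFn_smul c u] with x hx
    rw [hx, Pi.smul_apply, smul_comm]
  have e2 : ∫ x in O, φ x • (c • g : L2 O F) x = ∫ x in O, c • (φ x • g x) := by
    refine integral_congr_ae ?_
    filter_upwards [Lp.coeFn_smul c g] with x hx
    rw [hx, Pi.smul_apply, smul_comm]
  rw [e1, e2, integral_smul, integral_smul, h φ hφ, smul_neg]

theorem HasWeakPartial.zero {O : Set (E d)} {j : Fin d} :
    HasWeakPartial O j (0 : L2 O F) 0 := by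
  intro φ hφ
  have e1 : ∫ x in O, fderiv ℝ φ x (coordVec j) • (0 : L2 O F) x = 0 := by
    rw [← integral_zero (E d) F (μ := (volume : Measure (E d)).restrict O)]
    refine integral_congr_ae ?_
    filter_upwards [Lp.coeFn_zero F 2 ((volume : Measure (E d)).restrict O)] with x hx
    simp only [hx, Pi.zero_apply, smul_zero]
  have e2 : ∫ x in O, φ x • (0 : L2 O F) x = 0 := by
    rw [← integral_zero (E d) F (μ := (volume : Measure (E d)).restrict O)]
    refine integral_congr_ae ?_
    filter_upwards [Lp.coeFn_zero F 2 ((volume : Measure (E d)).restrict O)] with x hx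
    simp only [hx, Pi.zero_apply, smul_zero]
  rw [e1, e2, neg_zero]

theorem HasWeakDiv.add {O : Set (E d)} {u v : L2 O (E d)} {g k : L2 O ℝ}
    (h : HasWeakDiv O u g) (h' : HasWeakDiv O v k) : HasWeakDiv O (u + v) (g + k) := by
  intro φ hφ
  have e1 : ∫ x in O, fderiv ℝ φ x ((u + v : L2 O (E d)) x)
      = ∫ x in O, (fderiv ℝ φ x (u x) + fderiv ℝ φ x (v x)) := by
    refine integral_congr_ae ?_
    filter_upwards [Lp.coeFn_add u v] with x hx
    simp only [hx, Pi.add_apply, map_add]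
  have e2 : ∫ x in O, φ x • (g + k : L2 O ℝ) x = ∫ x in O, (φ x • g x + φ x • k x) := by
    refine integral_congr_ae ?_
    filter_upwards [Lp.coeFn_add g k] with x hx
    simp only [hx, Pi.add_apply, smul_add]
  rw [e1, e2, integral_add (integrable_fderiv_apply hφ u) (integrable_fderiv_apply hφ v),
    integral_add (integrable_test_smul hφ g) (integrable_test_smul hφ k), h φ hφ, h' φ hφ]
  ring

theorem HasWeakDiv.smul {O : Set (E d)} {u : L2 O (E d)} {g : L2 O ℝ} (c : ℝ)
    (h : HasWeakDiv O u g) : HasWeakDiv O (c • u) (c • g) := by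
  intro φ hφ
  have e1 : ∫ x in O, fderiv ℝ φ x ((c • u : L2 O (E d)) x)
      = ∫ x in O, c • fderiv ℝ φ x (u x) := by
    refine integral_congr_ae ?_
    filter_upwards [Lp.coeFn_smul c u] with x hx
    simp [hx]
  have e2 : ∫ x in O, φ x • (c • g : L2 O ℝ) x = ∫ x in O, c • (φ x • g x) := by
    refine integral_congr_ae ?_
    filter_upwards [Lp.coeFn_smul c g] with x hx
    simp only [hx, Pi.smul_apply, smul_eq_mul]
    ring
  rw [e1, e2, integral_smul, integral_smul, h φ hφ, smul_neg]

theorem HasWeakDiv.zero {O : Set (E d)} : HasWeakDiv O (0 : L2 O (E d)) 0 := by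
  intro φ hφ
  have e1 : ∫ x in O, fderiv ℝ φ x ((0 : L2 O (E d)) x) = 0 := by
    rw [← integral_zero (E d) ℝ (μ := (volume : Measure (E d)).restrict O)]
    refine integral_congr_ae ?_
    filter_upwards [Lp.coeFn_zero (E d) 2 ((volume : Measure (E d)).restrict O)] with x hx
    simp only [hx, Pi.zero_apply, map_zero]
  have e2 : ∫ x in O, φ x • (0 : L2 O ℝ) x = 0 := by
    rw [← integral_zero (E d) ℝ (μ := (volume : Measure (E d)).restrict O)]
    refine integral_congr_ae ?_
    filter_upwards [Lp.coeFn_zero ℝ 2 ((volume : Measure (E d)).restrict O)] with x hx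
    simp only [hx, Pi.zero_apply, smul_zero]
  rw [e1, e2, neg_zero]

/-- The Sobolev space `H¹(O; F)`. -/
def H1 (O : Set (E d)) (F : Type) [NormedAddCommGroup F] [NormedSpace ℝ F] :
    Submodule ℝ (L2 O F) where
  carrier := {u | ∀ j, ∃ g, HasWeakPartial O j u g}
  zero_mem' := fun _ => ⟨0, HasWeakPartial.zero⟩
  add_mem' := fun hu hv j => ⟨_, (hu j).choose_spec.add (hv j).choose_spec⟩
  smul_mem' := fun c _ hu j => ⟨_, (hu j).choose_spec.smul c⟩

/-- The `H¹` norm `(‖u‖² + ∑_j ‖∂_j u‖²)^{1/2}`, also for vector fields (product norm). -/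
def h1Norm {O : Set (E d)} (u : L2 O F) : ℝ :=
  Real.sqrt (‖u‖ ^ 2 + ∑ j, ‖weakPartial O j u‖ ^ 2)

/-- The space `H(div, O)`. -/
def Hdiv (O : Set (E d)) : Submodule ℝ (L2 O (E d)) where
  carrier := {u | ∃ g, HasWeakDiv O u g}
  zero_mem' := ⟨0, HasWeakDiv.zero⟩
  add_mem' := fun hu hv => ⟨_, hu.choose_spec.add hv.choose_spec⟩
  smul_mem' := fun c _ hu => ⟨_, hu.choose_spec.smul c⟩

/-- The `H(div)` norm `(‖u‖² + ‖div u‖²)^{1/2}`. -/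
def hdivNorm {O : Set (E d)} (u : L2 O (E d)) : ℝ :=
  Real.sqrt (‖u‖ ^ 2 + ‖weakDiv O u‖ ^ 2)

theorem weakDiv_add {O : Set (E d)} (hO : IsOpen O) {u v : L2 O (E d)}
    (hu : u ∈ Hdiv O) (hv : v ∈ Hdiv O) :
    weakDiv O (u + v) = weakDiv O u + weakDiv O v := by
  obtain ⟨g, hg⟩ := hu
  obtain ⟨k, hk⟩ := hv
  rw [weakDiv_eq hO hg, weakDiv_eq hO hk, weakDiv_eq hO (hg.add hk)]

theorem weakDiv_smul {O : Set (E d)} (hO : IsOpen O) (c : ℝ) {u : L2 O (E d)}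
    (hu : u ∈ Hdiv O) : weakDiv O (c • u) = c • weakDiv O u := by
  obtain ⟨g, hg⟩ := hu
  rw [weakDiv_eq hO hg, weakDiv_eq hO (hg.smul c)]

theorem weakDiv_zero {O : Set (E d)} (hO : IsOpen O) : weakDiv O (0 : L2 O (E d)) = 0 :=
  weakDiv_eq hO HasWeakDiv.zero

/-- `L²_0(O)`: square integrable functions with zero integral. -/
def L20 (O : Set (E d)) : Set (L2 O ℝ) := {p | ∫ x in O, p x = 0}

/-! ## Lipschitz polyhedra, outward normal -/

/-- Near each boundary point, `O` is the region strictly above the graph, in some direction `e`, of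
a Lipschitz function of the variables orthogonal to `e`. -/
def HasLipschitzBoundary (O : Set (E d)) : Prop :=
  ∀ x ∈ frontier O, ∃ (e : E d) (r : ℝ) (K : NNReal) (f : E d → ℝ),
    ‖e‖ = 1 ∧ 0 < r ∧ LipschitzWith K f ∧ (∀ y (t : ℝ), f (y + t • e) = f y) ∧
    ∀ y ∈ Metric.ball x r, (y ∈ O ↔ f y < ⟪e, y⟫)

/-- Bounded open sets with polyhedral Lipschitz boundary. -/
structure IsLipschitzPolyhedral (O : Set (E d)) : Prop where
  isOpen : IsOpen O
  isBounded : Bornology.IsBounded O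
  lipschitz : HasLipschitzBoundary O
  polyhedral : ∃ s : Finset (E d × ℝ), (∀ p ∈ s, p.1 ≠ 0) ∧
    frontier O ⊆ ⋃ p ∈ s, {x : E d | ⟪p.1, x⟫ = p.2}

/-- `n` is the unit outward normal of `O` at `x`, where `O` coincides near `x` with a
half-space. -/
def IsOutwardNormal (O : Set (E d)) (x n : E d) : Prop :=
  ‖n‖ = 1 ∧ ∃ ε > 0, ∀ y ∈ Metric.ball x ε, (y ∈ O ↔ ⟪y - x, n⟫ < 0)

open Classical in
/-- The unit outward normal field of a polyhedral set `O`, defined at the relative interior points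
of its faces, hence almost everywhere on the boundary (and set to zero elsewhere). -/
def outerNormal (O : Set (E d)) (x : E d) : E d :=
  if h : ∃ n, IsOutwardNormal O x n then h.choose else 0

theorem IsOutwardNormal.unique {O : Set (E d)} {x n m : E d}
    (hn : IsOutwardNormal O x n) (hm : IsOutwardNormal O x m) : n = m := by
  obtain ⟨hn1, ε, hε, hn⟩ := hn
  obtain ⟨hm1, δ, hδ, hm⟩ := hm
  -- the two half-spaces agree near `x`, hence everywhere by scaling
  have key : ∀ z : E d, ⟪z, n⟫ < 0 ↔ ⟪z, m⟫ < 0 := by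
    intro z
    set t : ℝ := min ε δ / (2 * (‖z‖ + 1)) with ht
    have hz : 0 < 2 * (‖z‖ + 1) := by positivity
    have htpos : 0 < t := div_pos (lt_min hε hδ) hz
    have hlt : ‖t • z‖ < min ε δ := by
      rw [norm_smul, Real.norm_of_nonneg htpos.le, ht, div_mul_eq_mul_div, div_lt_iff₀ hz]
      have := lt_min hε hδ
      nlinarith [norm_nonneg z]
    have h1 := hn (x + t • z) (by simpa using lt_of_lt_of_le hlt (min_le_left _ _))
    have h2 := hm (x + t • z) (by simpa using lt_of_lt_of_le hlt (min_le_right _ _))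
    have h3 := h1.symm.trans h2
    simpa [real_inner_smul_left, mul_neg_iff, htpos, htpos.le, not_lt.mpr htpos.le] using h3
  have hle : ∀ z : E d, ⟪z, n⟫ = 0 → ⟪z, m⟫ = 0 := by
    intro z hz
    have h1 : ¬ ⟪z, m⟫ < 0 := fun h => by have := (key z).mpr h; linarith
    have h2 : ¬ ⟪-z, m⟫ < 0 := fun h => by
      have := (key (-z)).mpr h
      rw [inner_neg_left] at this
      linarith
    rw [inner_neg_left] at h2
    linarith
  have hnn : ⟪n, n⟫ = 1 := by rw [real_inner_self_eq_norm_sq, hn1]; norm_num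
  have hmm : ⟪m, m⟫ = 1 := by rw [real_inner_self_eq_norm_sq, hm1]; norm_num
  set c : ℝ := ⟪m, n⟫ with hc
  have hort := hle (m - c • n) (by
    rw [inner_sub_left, real_inner_smul_left, hnn]; simp [hc])
  rw [inner_sub_left, real_inner_smul_left, hmm, real_inner_comm, ← hc] at hort
  have hcneg : ⟪-n, m⟫ < 0 := (key (-n)).mp (by rw [inner_neg_left, hnn]; norm_num)
  rw [inner_neg_left, real_inner_comm, ← hc] at hcneg
  have hc1 : c = 1 := by nlinarith
  have : ‖m - n‖ ^ 2 = 0 := by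
    rw [norm_sub_sq_real, hm1, hn1, ← hc, hc1]; norm_num
  have h0 : m - n = 0 := by simpa using this
  exact (sub_eq_zero.mp h0).symm

theorem outerNormal_eq {O : Set (E d)} {x n : E d} (h : IsOutwardNormal O x n) :
    outerNormal O x = n := by
  have hex : ∃ n, IsOutwardNormal O x n := ⟨n, h⟩
  rw [outerNormal, dif_pos hex]
  exact hex.choose_spec.unique h

theorem norm_outerNormal_le (O : Set (E d)) (x : E d) : ‖outerNormal O x‖ ≤ 1 := by
  by_cases hex : ∃ n, IsOutwardNormal O x n
  · obtain ⟨n, hn⟩ := hex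
    rw [outerNormal_eq hn, hn.1]
  · rw [outerNormal, dif_neg hex]; simp

theorem measurable_outerNormal (O : Set (E d)) : Measurable (outerNormal O) := by
  classical
  -- near a point with a normal `n`, the points of the tangent hyperplane have the same normal,
  -- and all other points have no normal at all
  have step : ∀ x n, IsOutwardNormal O x n → ∃ ε > 0, ∀ y ∈ Metric.ball x ε,
      (⟪y - x, n⟫ = 0 → IsOutwardNormal O y n) ∧
      (⟪y - x, n⟫ ≠ 0 → ¬ ∃ m, IsOutwardNormal O y m) := by
    rintro x n ⟨hn1, ε, hε, h⟩
    refine ⟨ε, hε, fun y hy => ⟨fun h0 => ?_, fun h0 => ?_⟩⟩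
    · obtain ⟨δ, hδ, hsub⟩ := Metric.isOpen_ball.mem_nhds hy |> Metric.mem_nhds_iff.mp
      refine ⟨hn1, δ, hδ, fun z hz => ?_⟩
      rw [h z (hsub hz)]
      have : z - x = (z - y) + (y - x) := by abel
      rw [this, inner_add_left, h0, add_zero]
    · rintro ⟨m, hm1, δ, hδ, hm⟩
      have hmm : ⟪m, m⟫ = 1 := by rw [real_inner_self_eq_norm_sq, hm1]; norm_num
      have hyO : y ∉ O := fun hyO => by
        have := (hm y (Metric.mem_ball_self hδ)).mp hyO
        simp at this
      have hpos : 0 < ⟪y - x, n⟫ :=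
        lt_of_le_of_ne (not_lt.mp fun hlt => hyO ((h y hy).mpr hlt)) (Ne.symm h0)
      have hc : Tendsto (fun t : ℝ => y - t • m) (𝓝[>] 0) (𝓝 y) := by
        have : Tendsto (fun t : ℝ => y - t • m) (𝓝 0) (𝓝 (y - (0 : ℝ) • m)) :=
          (Continuous.tendsto (by fun_prop) 0)
        simpa using this.mono_left nhdsWithin_le_nhds
      have hin : Continuous fun z : E d => ⟪z - x, n⟫ := by fun_prop
      have ev1 := hc.eventually (Metric.ball_mem_nhds y hδ)
      have ev2 := hc.eventually (Metric.isOpen_ball.mem_nhds hy)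
      have ev3 := hc.eventually (hin.continuousAt.eventually (lt_mem_nhds hpos))
      obtain ⟨t, h1, h2, h3, h4⟩ :=
        (ev1.and (ev2.and (ev3.and self_mem_nhdsWithin))).exists
      have h4' : (0 : ℝ) < t := h4
      have hO : y - t • m ∈ O := (hm _ h1).mpr (by
        have : y - t • m - y = -(t • m) := by abel
        rw [this, inner_neg_left, real_inner_smul_left, hmm]
        linarith)
      have := (h _ h2).mp hO
      linarith
  set V : Set (E d) := {x | ∃ n, IsOutwardNormal O x n} with hV
  have hcont : ContinuousOn (outerNormal O) V := by
    rintro x ⟨n, hn⟩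
    obtain ⟨ε, hε, h⟩ := step x n hn
    have : ∀ᶠ y in 𝓝[V] x, outerNormal O y = outerNormal O x := by
      filter_upwards [self_mem_nhdsWithin, mem_nhdsWithin_of_mem_nhds (Metric.ball_mem_nhds x hε)]
        with y hyV hy
      by_cases h0 : ⟪y - x, n⟫ = 0
      · rw [outerNormal_eq ((h y hy).1 h0), outerNormal_eq hn]
      · exact absurd hyV ((h y hy).2 h0)
    exact (tendsto_const_nhds.congr' (this.mono fun y hy => hy.symm))
  have hVm : MeasurableSet V := by
    -- `V` is locally closed
    have hloc : IsLocallyClosed V := by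
      rw [isLocallyClosed_iff_isOpen_coborder]
      rw [isOpen_iff_mem_nhds]
      intro x hx
      by_cases hxV : x ∈ V
      · obtain ⟨n, hn⟩ := hxV
        obtain ⟨ε, hε, h⟩ := step x n hn
        filter_upwards [Metric.ball_mem_nhds x hε] with y hy
        by_cases h0 : ⟪y - x, n⟫ = 0
        · exact subset_coborder ⟨n, (h y hy).1 h0⟩
        · rw [coborder, Set.mem_compl_iff, Set.mem_sdiff, not_and_or]
          left
          intro hcl
          have hin : Continuous fun z : E d => ⟪z - x, n⟫ := by fun_prop
          have hU : {z : E d | ⟪z - x, n⟫ ≠ 0} ∩ Metric.ball x ε ∈ 𝓝 y :=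
            inter_mem (hin.continuousAt.eventually_ne h0) (Metric.isOpen_ball.mem_nhds hy)
          obtain ⟨z, ⟨hz0, hzb⟩, hzV⟩ := mem_closure_iff_nhds.mp hcl _ hU
          exact (h z hzb).2 hz0 hzV
      · have hxc : x ∉ closure V := by
          rw [coborder, Set.mem_compl_iff, Set.mem_sdiff, not_and_or] at hx
          rcases hx with hx | hx
          · exact hx
          · exact absurd (not_not.mp hx) hxV
        filter_upwards [isClosed_closure.isOpen_compl.mem_nhds hxc] with y hy
        rw [coborder, Set.mem_compl_iff, Set.mem_sdiff]
        exact fun h => hy h.1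
    obtain ⟨U, Z, hU, hZ, e⟩ := hloc
    rw [e]
    exact hU.measurableSet.inter hZ.measurableSet
  have heq : outerNormal O = V.piecewise (outerNormal O) (fun _ => 0) := by
    funext x
    by_cases hx : x ∈ V
    · rw [Set.piecewise_eq_of_mem _ _ _ hx]
    · rw [Set.piecewise_eq_of_notMem _ _ _ hx, outerNormal, dif_neg (show ¬ ∃ n, IsOutwardNormal O x n from hx)]
  rw [heq]
  exact hcont.measurable_piecewise continuousOn_const hVm

/-! ## Traces -/

/-- `g` is the trace on `∂O` of `w ∈ H¹(O; F)`: `(w, g)` is the limit, in `H¹(O) × L²(∂O)`, of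
pairs `(v_n|_O, v_n|_{∂O})` with `v_n` smooth on `ℝ^d`. -/
def HasTrace (O : Set (E d)) (w : L2 O F) (g : L2Surf (frontier O) F) : Prop :=
  ∃ G : Fin d → L2 O F, (∀ j, HasWeakPartial O j w (G j)) ∧
    ∃ v : ℕ → E d → F, (∀ n, ContDiff ℝ ∞ (v n)) ∧
      Tendsto (fun n => eLpNorm (fun x => v n x - w x) 2 ((volume : Measure (E d)).restrict O))
        atTop (𝓝 0) ∧
      (∀ j, Tendsto (fun n => eLpNorm (fun x => fderiv ℝ (v n) x (coordVec j) - G j x) 2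
        ((volume : Measure (E d)).restrict O)) atTop (𝓝 0)) ∧
      Tendsto (fun n => eLpNorm (fun x => v n x - g x) 2 ((surf d).restrict (frontier O)))
        atTop (𝓝 0)

open Classical in
/-- The trace of `w ∈ H¹(O; F)` on `∂O`. -/
def trace (O : Set (E d)) (w : L2 O F) : L2Surf (frontier O) F :=
  if h : ∃ g, HasTrace O w g then h.choose else 0

theorem HasTrace.mem_H1 {O : Set (E d)} {w : L2 O F} {g : L2Surf (frontier O) F}
    (h : HasTrace O w g) : w ∈ H1 O F := by
  obtain ⟨G, hG, _⟩ := h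
  exact fun j => ⟨G j, hG j⟩

theorem tendsto_eLpNorm_sub_add {F : Type} [NormedAddCommGroup F] {μ : Measure (E d)} {a b : ℕ → E d → F}
    (f g : Lp F 2 μ) (ha : ∀ n, AEStronglyMeasurable (a n) μ)
    (hb : ∀ n, AEStronglyMeasurable (b n) μ)
    (hf : Tendsto (fun n => eLpNorm (fun x => a n x - f x) 2 μ) atTop (𝓝 0))
    (hg : Tendsto (fun n => eLpNorm (fun x => b n x - g x) 2 μ) atTop (𝓝 0)) :
    Tendsto (fun n => eLpNorm (fun x => (a n x + b n x) - (f + g : Lp F 2 μ) x) 2 μ)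
      atTop (𝓝 0) := by
  have h0 : Tendsto (fun n => eLpNorm (fun x => a n x - f x) 2 μ
      + eLpNorm (fun x => b n x - g x) 2 μ) atTop (𝓝 0) := by simpa using hf.add hg
  refine tendsto_of_tendsto_of_tendsto_of_le_of_le tendsto_const_nhds h0 (fun _ => zero_le)
    fun n => ?_
  have e : eLpNorm (fun x => (a n x + b n x) - (f + g : Lp F 2 μ) x) 2 μ
      = eLpNorm ((fun x => a n x - f x) + fun x => b n x - g x) 2 μ := by
    refine eLpNorm_congr_ae ?_
    filter_upwards [Lp.coeFn_add f g] with x hx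
    simp only [hx, Pi.add_apply]
    abel
  simp only [e]
  exact eLpNorm_add_le ((ha n).sub (Lp.aestronglyMeasurable f))
    ((hb n).sub (Lp.aestronglyMeasurable g)) (by norm_num)

theorem tendsto_eLpNorm_sub_smul {μ : Measure (E d)} {a : ℕ → E d → F} (c : ℝ)
    (f : Lp F 2 μ) (hf : Tendsto (fun n => eLpNorm (fun x => a n x - f x) 2 μ) atTop (𝓝 0)) :
    Tendsto (fun n => eLpNorm (fun x => c • a n x - (c • f : Lp F 2 μ) x) 2 μ)
      atTop (𝓝 0) := by
  have h0 : Tendsto (fun n => ‖c‖ₑ * eLpNorm (fun x => a n x - f x) 2 μ) atTop (𝓝 0) := by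
    have := ENNReal.Tendsto.const_mul (a := ‖c‖ₑ) hf (Or.inr (by simp))
    simpa using this
  refine h0.congr fun n => ?_
  rw [← eLpNorm_const_smul]
  refine eLpNorm_congr_ae ?_
  filter_upwards [Lp.coeFn_smul c f] with x hx
  simp [hx, smul_sub]

theorem HasTrace.add {O : Set (E d)} [SecondCountableTopology F] {w w' : L2 O F}
    {g g' : L2Surf (frontier O) F} (h : HasTrace O w g) (h' : HasTrace O w' g') :
    HasTrace O (w + w') (g + g') := by
  obtain ⟨G, hG, v, hv, h1, h2, h3⟩ := h
  obtain ⟨G', hG', v', hv', h1', h2', h3'⟩ := h'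
  refine ⟨fun j => G j + G' j, fun j => (hG j).add (hG' j), fun n x => v n x + v' n x,
    fun n => (hv n).add (hv' n), ?_, fun j => ?_, ?_⟩
  · exact tendsto_eLpNorm_sub_add w w' (fun n => (hv n).continuous.aestronglyMeasurable)
      (fun n => (hv' n).continuous.aestronglyMeasurable) h1 h1'
  · have hc : ∀ {f : E d → F}, ContDiff ℝ ∞ f →
        Continuous fun x => fderiv ℝ f x (coordVec j) := fun hf =>
      (hf.continuous_fderiv (by simp)).clm_apply continuous_const
    have := tendsto_eLpNorm_sub_add (G j) (G' j)
      (fun n => (hc (hv n)).aestronglyMeasurable)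
      (fun n => (hc (hv' n)).aestronglyMeasurable) (h2 j) (h2' j)
    refine this.congr fun n => ?_
    congr 1
    funext x
    have e : fderiv ℝ (fun x => v n x + v' n x) x = fderiv ℝ (v n) x + fderiv ℝ (v' n) x :=
      fderiv_fun_add ((hv n).differentiable (by simp) x) ((hv' n).differentiable (by simp) x)
    rw [e]
    rfl
  · exact tendsto_eLpNorm_sub_add g g' (fun n => (hv n).continuous.aestronglyMeasurable)
      (fun n => (hv' n).continuous.aestronglyMeasurable) h3 h3'

theorem HasTrace.smul {O : Set (E d)} {w : L2 O F} {g : L2Surf (frontier O) F} (c : ℝ)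
    (h : HasTrace O w g) : HasTrace O (c • w) (c • g) := by
  obtain ⟨G, hG, v, hv, h1, h2, h3⟩ := h
  refine ⟨fun j => c • G j, fun j => (hG j).smul c, fun n x => c • v n x,
    fun n => contDiff_const.smul (hv n), tendsto_eLpNorm_sub_smul c w h1, fun j => ?_,
    tendsto_eLpNorm_sub_smul c g h3⟩
  refine (tendsto_eLpNorm_sub_smul c (G j) (h2 j)).congr fun n => ?_
  congr 1
  funext x
  have e : fderiv ℝ (fun x => c • v n x) x = c • fderiv ℝ (v n) x :=
    fderiv_fun_const_smul ((hv n).differentiable (by simp) x) c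
  rw [e]
  rfl

theorem HasTrace.zero {O : Set (E d)} : HasTrace O (0 : L2 O F) 0 := by
  have key : ∀ μ : Measure (E d),
      Tendsto (fun _ : ℕ => eLpNorm (fun x => (0 : F) - (0 : Lp F 2 μ) x) 2 μ) atTop (𝓝 0) := by
    intro μ
    have : eLpNorm (fun x => (0 : F) - (0 : Lp F 2 μ) x) 2 μ = 0 := by
      rw [← eLpNorm_zero (ε := F) (p := 2) (μ := μ)]
      refine eLpNorm_congr_ae ?_
      filter_upwards [Lp.coeFn_zero F 2 μ] with x hx
      simp only [hx, Pi.zero_apply, sub_zero]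
    simp only [this]
    exact tendsto_const_nhds
  refine ⟨fun _ => 0, fun _ => HasWeakPartial.zero, fun _ _ => 0, fun _ => contDiff_const,
    key _, fun j => ?_, key _⟩
  simpa using key ((volume : Measure (E d)).restrict O)

/-- A boundary function `g ∈ L²(∂O; F)` vanishes almost everywhere on the part `S` of `∂O`. -/
def VanishesOn {O : Set (E d)} (g : L2Surf (frontier O) F) (S : Set (E d)) : Prop :=
  ∀ᵐ x ∂(surf d).restrict (frontier O), x ∈ S → g x = 0

theorem VanishesOn.add {F : Type} [NormedAddCommGroup F] {O S : Set (E d)} {g k : L2Surf (frontier O) F}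
    (h : VanishesOn g S) (h' : VanishesOn k S) : VanishesOn (g + k) S := by
  filter_upwards [h, h', Lp.coeFn_add g k] with x h1 h2 h3 hx
  rw [h3, Pi.add_apply, h1 hx, h2 hx, add_zero]

theorem VanishesOn.smul {O S : Set (E d)} {g : L2Surf (frontier O) F} (c : ℝ)
    (h : VanishesOn g S) : VanishesOn (c • g) S := by
  filter_upwards [h, Lp.coeFn_smul c g] with x h1 h3 hx
  rw [h3, Pi.smul_apply, h1 hx, smul_zero]

theorem VanishesOn.zero {F : Type} [NormedAddCommGroup F] {O S : Set (E d)} : VanishesOn (0 : L2Surf (frontier O) F) S := by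
  filter_upwards [Lp.coeFn_zero F 2 ((surf d).restrict (frontier O))] with x h3 _
  rw [h3, Pi.zero_apply]

/-- Functions of `H¹(O; F)` with zero trace on the part `S` of `∂O`. -/
def H1Vanishing (O : Set (E d)) (F : Type) [NormedAddCommGroup F] [NormedSpace ℝ F]
    [SecondCountableTopology F] (S : Set (E d)) : Submodule ℝ (L2 O F) where
  carrier := {u | ∃ g, HasTrace O u g ∧ VanishesOn g S}
  zero_mem' := ⟨0, HasTrace.zero, VanishesOn.zero⟩
  add_mem' := by
    rintro _ _ ⟨g, hg, hg'⟩ ⟨k, hk, hk'⟩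
    exact ⟨g + k, hg.add hk, hg'.add hk'⟩
  smul_mem' := by
    rintro c _ ⟨g, hg, hg'⟩
    exact ⟨c • g, hg.smul c, hg'.smul c⟩

/-- The duality pairing `⟨u·n, w⟩_{∂O} = ∫_O u·∇w + ∫_O (div u) w` of the normal trace of
`u ∈ H(div, O)` (`n` the outward normal of `O`) with the trace of `w ∈ H¹(O)`. -/
def normalPairing (O : Set (E d)) (u : L2 O (E d)) (w : L2 O ℝ) : ℝ :=
  (∑ j, ∫ x in O, u x j * weakPartial O j w x) + ∫ x in O, weakDiv O u x * w x

theorem memLp_coord {O : Set (E d)} (u : L2 O (E d)) (j : Fin d) :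
    MemLp (fun x => u x j) 2 ((volume : Measure (E d)).restrict O) :=
  (EuclideanSpace.proj j : E d →L[ℝ] ℝ).comp_memLp' (Lp.memLp u)

theorem normalPairing_add {O : Set (E d)} (hO : IsOpen O) {u v : L2 O (E d)}
    (hu : u ∈ Hdiv O) (hv : v ∈ Hdiv O) (w : L2 O ℝ) :
    normalPairing O (u + v) w = normalPairing O u w + normalPairing O v w := by
  have e1 : ∀ j, ∫ x in O, (u + v : L2 O (E d)) x j * weakPartial O j w x
      = (∫ x in O, u x j * weakPartial O j w x) + ∫ x in O, v x j * weakPartial O j w x := by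
    intro j
    have i1 : Integrable (fun x => u x j * weakPartial O j w x)
        ((volume : Measure (E d)).restrict O) := (memLp_coord u j).integrable_mul (Lp.memLp _)
    have i2 : Integrable (fun x => v x j * weakPartial O j w x)
        ((volume : Measure (E d)).restrict O) := (memLp_coord v j).integrable_mul (Lp.memLp _)
    rw [← integral_add i1 i2]
    refine integral_congr_ae ?_
    filter_upwards [Lp.coeFn_add u v] with x hx
    simp only [hx, Pi.add_apply, PiLp.add_apply, add_mul]
  have e2 : ∫ x in O, weakDiv O (u + v) x * w x
      = (∫ x in O, weakDiv O u x * w x) + ∫ x in O, weakDiv O v x * w x := by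
    have i1 : Integrable (fun x => weakDiv O u x * w x)
        ((volume : Measure (E d)).restrict O) := (Lp.memLp _).integrable_mul (Lp.memLp _)
    have i2 : Integrable (fun x => weakDiv O v x * w x)
        ((volume : Measure (E d)).restrict O) := (Lp.memLp _).integrable_mul (Lp.memLp _)
    rw [weakDiv_add hO hu hv, ← integral_add i1 i2]
    refine integral_congr_ae ?_
    filter_upwards [Lp.coeFn_add (weakDiv O u) (weakDiv O v)] with x hx
    simp only [hx, Pi.add_apply, add_mul]
  simp only [normalPairing, e1, e2, Finset.sum_add_distrib]
  ring

theorem normalPairing_smul {O : Set (E d)} (hO : IsOpen O) (c : ℝ) {u : L2 O (E d)}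
    (hu : u ∈ Hdiv O) (w : L2 O ℝ) :
    normalPairing O (c • u) w = c * normalPairing O u w := by
  have e1 : ∀ j, ∫ x in O, (c • u : L2 O (E d)) x j * weakPartial O j w x
      = c * ∫ x in O, u x j * weakPartial O j w x := by
    intro j
    rw [← integral_const_mul]
    refine integral_congr_ae ?_
    filter_upwards [Lp.coeFn_smul c u] with x hx
    simp [hx, mul_assoc]
  have e2 : ∫ x in O, weakDiv O (c • u) x * w x = c * ∫ x in O, weakDiv O u x * w x := by
    rw [weakDiv_smul hO c hu, ← integral_const_mul]
    refine integral_congr_ae ?_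
    filter_upwards [Lp.coeFn_smul c (weakDiv O u)] with x hx
    simp [hx, mul_assoc]
  simp only [normalPairing, e1, e2, ← Finset.mul_sum]
  ring

theorem normalPairing_zero {O : Set (E d)} (hO : IsOpen O) (w : L2 O ℝ) :
    normalPairing O 0 w = 0 := by
  simpa using normalPairing_smul hO 0 (Hdiv O).zero_mem w

/-- Fields `u ∈ H(div, O)` with `u · n = 0` on `∂O \ S`, in the sense that
`⟨u·n, w⟩_{∂O} = 0` for all `w ∈ H¹(O)` whose trace vanishes on `S`. For `S = ∅` this is
`H_0(div, O)`. -/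
def HdivVanishingOff (O : Set (E d)) (hO : IsOpen O) (S : Set (E d)) :
    Submodule ℝ (L2 O (E d)) where
  carrier := {u | u ∈ Hdiv O ∧ ∀ w ∈ H1Vanishing O ℝ S, normalPairing O u w = 0}
  zero_mem' := ⟨(Hdiv O).zero_mem, fun w _ => normalPairing_zero hO w⟩
  add_mem' := by
    rintro u v ⟨hu, hu'⟩ ⟨hv, hv'⟩
    exact ⟨(Hdiv O).add_mem hu hv, fun w hw => by
      rw [normalPairing_add hO hu hv, hu' w hw, hv' w hw, add_zero]⟩
  smul_mem' := by
    rintro c u ⟨hu, hu'⟩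
    exact ⟨(Hdiv O).smul_mem c hu, fun w hw => by
      rw [normalPairing_smul hO c hu, hu' w hw, mul_zero]⟩

/-! ## Geometry -/

/-- A bounded open set `Ω ⊂ ℝ^d` subdivided into a Stokes part `ΩS` and a Darcy part `ΩD` by an
interface contained in both boundaries; all three sets are Lipschitz polyhedra. -/
structure Geometry (d : ℕ) where
  Ω : Set (E d)
  ΩS : Set (E d)
  ΩD : Set (E d)
  polyΩ : IsLipschitzPolyhedral Ω
  polyS : IsLipschitzPolyhedral ΩS
  polyD : IsLipschitzPolyhedral ΩD
  disjoint : Disjoint ΩS ΩD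
  subdivision : Ω = ΩS ∪ (Ω ∩ (frontier ΩS ∩ frontier ΩD)) ∪ ΩD

namespace Geometry

variable (G : Geometry d)

/-- The interface `Σ`. -/
def interface : Set (E d) := G.Ω ∩ (frontier G.ΩS ∩ frontier G.ΩD)

/-- `Γ_S = ∂Ω_S \ Σ`. -/
def ΓS : Set (E d) := frontier G.ΩS \ G.interface

/-- `Γ_D = ∂Ω_D \ Σ`. -/
def ΓD : Set (E d) := frontier G.ΩD \ G.interface

/-- `L²(Σ)`. -/
abbrev L2I : Type := L2Surf G.interface ℝ

/-- The unit normal on `Σ` pointing from `Ω_S` to `Ω_D`. -/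
def normal (x : E d) : E d := outerNormal G.ΩS x

theorem memLp_normalComp (g : L2Surf (frontier G.ΩS) (E d)) :
    MemLp (fun x => ⟪g x, G.normal x⟫) 2 ((surf d).restrict G.interface) := by
  have hsub : G.interface ⊆ frontier G.ΩS := fun x hx => hx.2.1
  have h1 : MemLp g 2 ((surf d).restrict G.interface) :=
    (Lp.memLp g).mono_measure (Measure.restrict_mono hsub le_rfl)
  refine h1.of_le (h1.1.inner (measurable_outerNormal G.ΩS).aestronglyMeasurable)
    (Eventually.of_forall fun x => ?_)
  calc ‖⟪g x, G.normal x⟫‖ ≤ ‖g x‖ * ‖G.normal x‖ := norm_inner_le_norm _ _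
    _ ≤ ‖g x‖ * 1 := by gcongr; exact norm_outerNormal_le _ _
    _ = ‖g x‖ := mul_one _

/-- The normal component `g · ν ∈ L²(Σ)` of a vector field `g` on `∂Ω_S`. -/
def normalComp (g : L2Surf (frontier G.ΩS) (E d)) : G.L2I := (G.memLp_normalComp g).toLp

theorem ae_interface_of_ae {p : E d → Prop}
    (h : ∀ᵐ x ∂(surf d).restrict (frontier G.ΩS), p x) :
    ∀ᵐ x ∂(surf d).restrict G.interface, p x :=
  ae_mono (Measure.restrict_mono (fun _ hx => hx.2.1) le_rfl) h

theorem normalComp_add (g k : L2Surf (frontier G.ΩS) (E d)) :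
    G.normalComp (g + k) = G.normalComp g + G.normalComp k := by
  refine Lp.ext ?_
  filter_upwards [(G.memLp_normalComp (g + k)).coeFn_toLp, (G.memLp_normalComp g).coeFn_toLp,
    (G.memLp_normalComp k).coeFn_toLp, Lp.coeFn_add (G.normalComp g) (G.normalComp k),
    G.ae_interface_of_ae (Lp.coeFn_add g k)] with x h1 h2 h3 h4 h5
  rw [h4, Pi.add_apply]
  simp only [normalComp, h1, h2, h3, h5, Pi.add_apply, inner_add_left]

theorem normalComp_smul (c : ℝ) (g : L2Surf (frontier G.ΩS) (E d)) :
    G.normalComp (c • g) = c • G.normalComp g := by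
  refine Lp.ext ?_
  filter_upwards [(G.memLp_normalComp (c • g)).coeFn_toLp, (G.memLp_normalComp g).coeFn_toLp,
    Lp.coeFn_smul c (G.normalComp g),
    G.ae_interface_of_ae (Lp.coeFn_smul c g)] with x h1 h2 h4 h5
  rw [h4, Pi.smul_apply]
  simp only [normalComp, h1, h2, h5, Pi.smul_apply, real_inner_smul_left, smul_eq_mul]

/-! ### The continuous spaces -/

/-- `H¹_S(Ω_S)`: vector fields in `H¹(Ω_S)` vanishing on `Γ_S`. -/
def H1S : Submodule ℝ (L2 G.ΩS (E d)) := H1Vanishing G.ΩS (E d) G.ΓS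

/-- `H¹_0(Ω_S)`: vector fields in `H¹(Ω_S)` vanishing on `∂Ω_S`. -/
def H10 : Submodule ℝ (L2 G.ΩS (E d)) := H1Vanishing G.ΩS (E d) (frontier G.ΩS)

/-- `H_D(div, Ω_D)`: fields in `H(div, Ω_D)` with `u · ν = 0` on `Γ_D`. -/
def HdivD : Submodule ℝ (L2 G.ΩD (E d)) := HdivVanishingOff G.ΩD G.polyD.isOpen G.interface

/-- `H_0(div, Ω_D)`: fields in `H(div, Ω_D)` with `u · ν = 0` on `∂Ω_D`. -/
def Hdiv0 : Submodule ℝ (L2 G.ΩD (E d)) := HdivVanishingOff G.ΩD G.polyD.isOpen ∅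

/-- `u · ν = r` on `Σ`, for `u ∈ H(div, Ω_D)` and `r ∈ L²(Σ)`:
the identity `⟨u·ν, w⟩_Σ = ∫_Σ r w` holds for all `w ∈ H¹(Ω_D)` with trace zero on `Γ_D`.
The minus sign is there because `ν` points into `Ω_D`. -/
def HasNormalTrace (u : L2 G.ΩD (E d)) (r : G.L2I) : Prop :=
  ∀ (w : L2 G.ΩD ℝ) (g : L2Surf (frontier G.ΩD) ℝ), HasTrace G.ΩD w g → VanishesOn g G.ΓD →
    - normalPairing G.ΩD u w = ∫ x in G.interface, r x * g x ∂(surf d)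

theorem integrable_interface_mul (r : G.L2I) (g : L2Surf (frontier G.ΩD) ℝ) :
    Integrable (fun x => r x * g x) ((surf d).restrict G.interface) :=
  (Lp.memLp r).integrable_mul
    ((Lp.memLp g).mono_measure (Measure.restrict_mono (fun _ hx => hx.2.2) le_rfl))

theorem HasNormalTrace.add {u v : L2 G.ΩD (E d)} {r s : G.L2I} (hu : u ∈ Hdiv G.ΩD)
    (hv : v ∈ Hdiv G.ΩD) (h : G.HasNormalTrace u r) (h' : G.HasNormalTrace v s) :
    G.HasNormalTrace (u + v) (r + s) := by
  intro w g hw hg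
  have e : ∫ x in G.interface, (r + s : G.L2I) x * g x ∂(surf d)
      = (∫ x in G.interface, r x * g x ∂(surf d)) + ∫ x in G.interface, s x * g x ∂(surf d) := by
    rw [← integral_add (G.integrable_interface_mul r g) (G.integrable_interface_mul s g)]
    refine integral_congr_ae ?_
    filter_upwards [Lp.coeFn_add r s] with x hx
    simp only [hx, Pi.add_apply, add_mul]
  rw [e, normalPairing_add G.polyD.isOpen hu hv, ← h w g hw hg, ← h' w g hw hg]
  ring

theorem HasNormalTrace.smul (c : ℝ) {u : L2 G.ΩD (E d)} {r : G.L2I} (hu : u ∈ Hdiv G.ΩD)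
    (h : G.HasNormalTrace u r) : G.HasNormalTrace (c • u) (c • r) := by
  intro w g hw hg
  have e : ∫ x in G.interface, (c • r : G.L2I) x * g x ∂(surf d)
      = c * ∫ x in G.interface, r x * g x ∂(surf d) := by
    rw [← integral_const_mul]
    refine integral_congr_ae ?_
    filter_upwards [Lp.coeFn_smul c r] with x hx
    simp [hx, mul_assoc]
  rw [e, normalPairing_smul G.polyD.isOpen c hu, ← h w g hw hg]
  ring

theorem HasNormalTrace.zero : G.HasNormalTrace 0 0 := by
  simpa using HasNormalTrace.smul G 0 (u := 0) (r := 0) (Hdiv G.ΩD).zero_mem (by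
    intro w g _ _
    rw [normalPairing_zero G.polyD.isOpen, neg_zero,
      ← integral_zero (E d) ℝ (μ := (surf d).restrict G.interface)]
    refine integral_congr_ae ?_
    filter_upwards [Lp.coeFn_zero ℝ 2 ((surf d).restrict G.interface)] with x hx
    simp only [hx, Pi.zero_apply, zero_mul])

/-- `w ∈ H¹(Ω_D)` has trace equal to the extension by zero of `ψ ∈ L²(Σ)` to `∂Ω_D`. -/
def ExtendsToH1 (ψ : G.L2I) (w : L2 G.ΩD ℝ) : Prop :=
  ∃ g : L2Surf (frontier G.ΩD) ℝ, HasTrace G.ΩD w g ∧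
    g =ᵐ[(surf d).restrict (frontier G.ΩD)] G.interface.indicator ψ

/-- `ψ ∈ H^{1/2}_{00}(Σ)`: the extension of `ψ` by zero is in `H^{1/2}(∂Ω_D)`, the image of the
trace operator of `H¹(Ω_D)`. -/
def MemH00 (ψ : G.L2I) : Prop := ∃ w, G.ExtendsToH1 ψ w

/-- The norm of `H^{1/2}_{00}(Σ)`: the quotient norm of the zero extension in
`H^{1/2}(∂Ω_D)`. -/
def h00Norm (ψ : G.L2I) : ℝ := sInf {t | ∃ w, G.ExtendsToH1 ψ w ∧ t = h1Norm w}

/-- The norm of `φ ∈ L²(Σ)` in `H^{-1/2}_{00}(Σ)`, the dual of `H^{1/2}_{00}(Σ)` with pivot space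
`L²(Σ)`. -/
def h00DualNorm (φ : G.L2I) : ℝ :=
  sSup {t | ∃ ψ : G.L2I, G.MemH00 ψ ∧ G.h00Norm ψ ≤ 1 ∧ t = |⟪φ, ψ⟫|}

/-- The ambient space of velocity pairs `(u_S, u_D)`. -/
abbrev VelPair : Type := L2 G.ΩS (E d) × L2 G.ΩD (E d)

/-- The ambient space of pressure triples `((q_S, q_D), δ)`. -/
abbrev PressTriple : Type := (L2 G.ΩS ℝ × L2 G.ΩD ℝ) × ℝ

/-- `‖(u_S, u_D)‖_𝕏 = (‖u_S‖²_{H¹(Ω_S)} + ‖u_D‖²_{H(div, Ω_D)})^{1/2}`. -/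
def velNorm (u : G.VelPair) : ℝ := Real.sqrt (h1Norm u.1 ^ 2 + hdivNorm u.2 ^ 2)

/-- The product norm on pressure triples. -/
def pressNorm (q : G.PressTriple) : ℝ := Real.sqrt (‖q.1.1‖ ^ 2 + ‖q.1.2‖ ^ 2 + q.2 ^ 2)

/-- The flux `⟨u · ν, 1⟩_Σ` of `u ∈ H¹(Ω_S)` through the interface. -/
def flux (u : L2 G.ΩS (E d)) : ℝ :=
  ∫ x in G.interface, G.normalComp (trace G.ΩS u) x ∂(surf d)

/-- `b(u, (q, δ)) = (div u_S, q_S)_{Ω_S} + (div u_D, q_D)_{Ω_D} + δ ⟨u_S · ν, 1⟩_Σ`. -/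
def b (u : G.VelPair) (q : G.PressTriple) : ℝ :=
  ⟪weakDiv G.ΩS u.1, q.1.1⟫ + ⟪weakDiv G.ΩD u.2, q.1.2⟫ + q.2 * G.flux u.1

end Geometry

/-! ## Discretization -/

/-- Families, indexed by the discretization parameter `h : ι`, of finite dimensional spaces
`H^h(Ω_S) ⊂ H¹(Ω_S)`, `H^h(Ω_D) ⊂ H(div, Ω_D)`, `L^h_0(Ω_S) ⊂ L²_0(Ω_S)` and
`L^h_0(Ω_D) ⊂ L²_0(Ω_D)`. Piecewise polynomial spaces on triangulations are the main example, but
the spaces may be arbitrary. -/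
structure Discretization (G : Geometry d) (ι : Type*) where
  HS : ι → Submodule ℝ (L2 G.ΩS (E d))
  HD : ι → Submodule ℝ (L2 G.ΩD (E d))
  LS0 : ι → Submodule ℝ (L2 G.ΩS ℝ)
  LD0 : ι → Submodule ℝ (L2 G.ΩD ℝ)
  finHS : ∀ h, FiniteDimensional ℝ (HS h)
  finHD : ∀ h, FiniteDimensional ℝ (HD h)
  finLS0 : ∀ h, FiniteDimensional ℝ (LS0 h)
  finLD0 : ∀ h, FiniteDimensional ℝ (LD0 h)
  HS_le : ∀ h, HS h ≤ H1 G.ΩS (E d)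
  HD_le : ∀ h, HD h ≤ Hdiv G.ΩD
  LS0_sub : ∀ h, (LS0 h : Set (L2 G.ΩS ℝ)) ⊆ L20 G.ΩS
  LD0_sub : ∀ h, (LD0 h : Set (L2 G.ΩD ℝ)) ⊆ L20 G.ΩD

/-- Uniform inf-sup condition of `c` for the pairs `{S h, T h}`: there is `β > 0` with
`sup_{0 ≠ s ∈ S h} c(s, t) / ‖s‖ ≥ β ‖t‖` for all `t ∈ T h` and all `h`. -/
def UniformInfSup {ι X Q : Type*} [AddCommGroup X] [Module ℝ X] [AddCommGroup Q] [Module ℝ Q]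
    (S : ι → Submodule ℝ X) (T : ι → Submodule ℝ Q) (normX : X → ℝ) (normQ : Q → ℝ)
    (c : X → Q → ℝ) : Prop :=
  ∃ β > 0, ∀ h, ∀ t ∈ T h, β * normQ t ≤ ⨆ s : {s : X // s ∈ S h ∧ s ≠ 0}, c s t / normX s

namespace Discretization

variable {G : Geometry d} {ι : Type*} (D : Discretization G ι)

/-- `H^h_0(Ω_S) = H^h(Ω_S) ∩ H¹_0(Ω_S)`. -/
def HS0 (h : ι) : Submodule ℝ (L2 G.ΩS (E d)) := D.HS h ⊓ G.H10

/-- `H^h_0(Ω_D) = H^h(Ω_D) ∩ H_0(div, Ω_D)`. -/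
def HD0 (h : ι) : Submodule ℝ (L2 G.ΩD (E d)) := D.HD h ⊓ G.Hdiv0

/-- `H^h_S(Ω_S) = H^h(Ω_S) ∩ H¹_S(Ω_S)`. -/
def HSS (h : ι) : Submodule ℝ (L2 G.ΩS (E d)) := D.HS h ⊓ G.H1S

/-- `H^h_D(Ω_D) = H^h(Ω_D) ∩ H_D(div, Ω_D)`. -/
def HDD (h : ι) : Submodule ℝ (L2 G.ΩD (E d)) := D.HD h ⊓ G.HdivD

/-- `L^h(Ω_D) = L^h_0(Ω_D) ⊕ ℙ_0(Ω_D)`. -/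
def LD (h : ι) : Set (L2 G.ΩD ℝ) :=
  {p | ∃ q ∈ D.LD0 h, ∃ c : ℝ, ∀ᵐ x ∂(volume : Measure (E d)).restrict G.ΩD, p x = q x + c}

/-- `Φ^h_D ⊂ L²(Σ)`: the normal components on `Σ` of the fields in `H^h_D(Ω_D)`. -/
def ΦD (h : ι) : Submodule ℝ G.L2I where
  carrier := {r | ∃ u ∈ D.HDD h, G.HasNormalTrace u r}
  zero_mem' := ⟨0, (D.HDD h).zero_mem, Geometry.HasNormalTrace.zero G⟩
  add_mem' := by
    rintro r s ⟨u, hu, hr⟩ ⟨v, hv, hs⟩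
    exact ⟨u + v, (D.HDD h).add_mem hu hv,
      Geometry.HasNormalTrace.add G (D.HD_le h hu.1) (D.HD_le h hv.1) hr hs⟩
  smul_mem' := by
    rintro c r ⟨u, hu, hr⟩
    exact ⟨c • u, (D.HDD h).smul_mem c hu,
      Geometry.HasNormalTrace.smul G c (D.HD_le h hu.1) hr⟩

/-- `r = R^h_D f`: `r` is the `L²(Σ)`-orthogonal projection of `f` onto `Φ^h_D`. -/
def IsProjΦD (h : ι) (f r : G.L2I) : Prop := r ∈ D.ΦD h ∧ ∀ φ ∈ D.ΦD h, ⟪f - r, φ⟫ = 0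

/-- The discrete velocity space `𝕏^h`: pairs `(u_S, u_D) ∈ H^h_S(Ω_S) × H^h_D(Ω_D)` with
`u_D · ν = R^h_D (u_S · ν)` on `Σ`. -/
def Xh (h : ι) : Submodule ℝ G.VelPair where
  carrier := {u | u.1 ∈ D.HSS h ∧ u.2 ∈ D.HDD h ∧ ∃ g r, HasTrace G.ΩS u.1 g ∧
    D.IsProjΦD h (G.normalComp g) r ∧ G.HasNormalTrace u.2 r}
  zero_mem' := by
    refine ⟨(D.HSS h).zero_mem, (D.HDD h).zero_mem, 0, 0, HasTrace.zero,
      ⟨(D.ΦD h).zero_mem, fun φ _ => ?_⟩, Geometry.HasNormalTrace.zero G⟩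
    have : G.normalComp 0 = 0 := by simpa using G.normalComp_smul 0 0
    simp [this]
  add_mem' := by
    rintro u v ⟨hu1, hu2, g, r, hg, hr, hn⟩ ⟨hv1, hv2, k, s, hk, hs, hm⟩
    refine ⟨(D.HSS h).add_mem hu1 hv1, (D.HDD h).add_mem hu2 hv2, g + k, r + s, hg.add hk,
      ⟨(D.ΦD h).add_mem hr.1 hs.1, fun φ hφ => ?_⟩,
      Geometry.HasNormalTrace.add G (D.HD_le h hu2.1) (D.HD_le h hv2.1) hn hm⟩
    have e : G.normalComp g + G.normalComp k - (r + s)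
        = (G.normalComp g - r) + (G.normalComp k - s) := by abel
    rw [G.normalComp_add, e, inner_add_left, hr.2 φ hφ, hs.2 φ hφ, add_zero]
  smul_mem' := by
    rintro c u ⟨hu1, hu2, g, r, hg, hr, hn⟩
    refine ⟨(D.HSS h).smul_mem c hu1, (D.HDD h).smul_mem c hu2, c • g, c • r, hg.smul c,
      ⟨(D.ΦD h).smul_mem c hr.1, fun φ hφ => ?_⟩,
      Geometry.HasNormalTrace.smul G c (D.HD_le h hu2.1) hn⟩
    rw [G.normalComp_smul, ← smul_sub, real_inner_smul_left, hr.2 φ hφ, mul_zero]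

/-- The discrete pressure space `ℚ^h = L^h_0(Ω_S) × L^h_0(Ω_D) × ℝ`. -/
def Qh (h : ι) : Submodule ℝ G.PressTriple := ((D.LS0 h).prod (D.LD0 h)).prod ⊤

/-- First hypothesis: the Stokes pair and the Darcy pair are uniformly stable for homogeneous
boundary conditions, and `div H^h(Ω_D) ⊂ L^h(Ω_D)`. -/
structure Hypothesis1 : Prop where
  stokes : UniformInfSup D.HS0 D.LS0 h1Norm norm (fun u q => ⟪weakDiv G.ΩS u, q⟫)
  darcy : UniformInfSup D.HD0 D.LD0 hdivNorm norm (fun u q => ⟪weakDiv G.ΩD u, q⟫)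
  div_sub : ∀ h, ∀ u ∈ D.HD h, weakDiv G.ΩD u ∈ D.LD h

/-- A stable lifting of the normal trace: linear right inverses
`𝐋^h : Φ^h_D → H^h_D(Ω_D)` of the normal trace, bounded uniformly in `h` from the norm of
`H^{-1/2}_{00}(Σ)` to that of `H(div, Ω_D)`. -/
def HasStableLifting : Prop :=
  ∃ C > 0, ∀ h, ∃ L : D.ΦD h →ₗ[ℝ] D.HDD h, ∀ φ : D.ΦD h,
    G.HasNormalTrace (L φ : L2 G.ΩD (E d)) φ ∧
    hdivNorm (L φ : L2 G.ΩD (E d)) ≤ C * G.h00DualNorm φ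

/-- Second hypothesis: discrete fields of bounded norm with flux through `Σ` bounded below, and
existence of a stable lifting of the normal trace. -/
structure Hypothesis2 : Prop where
  permeability : ∃ β₀ > 0, ∃ β₁ > 0, ∀ h, ∃ v ∈ D.HSS h, β₀ ≤ G.flux v ∧ h1Norm v ≤ β₁
  lifting : D.HasStableLifting

end Discretization

end StokesDarcy

end

open MeasureTheory Filter Topology
open scoped ContDiff RealInnerProductSpace

noncomputable section

namespace StokesDarcy

open scoped ENNReal NNReal

variable {d : ℕ}
variable {F : Type} [NormedAddCommGroup F] [NormedSpace ℝ F]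

/-! Fix t = (q_S, q_D, δ) and let σ be the supremum of b(u, t)/‖u‖ over 𝕏^h. Each component of t has
to be bounded by σ times a constant independent of h. For u in H^h_0(Ω_S) the pair (u, 0) lies in
𝕏^h, because both normal components on Σ vanish, and b reduces to (div u, q_S); the Stokes condition
then gives ‖q_S‖ ≤ σ/β_S. The pairs (0, u) with u in H^h_0(Ω_D) give ‖q_D‖ ≤ σ/β_D. For δ one uses z
= (v_h, 𝐋^h R^h_D(v_h·ν)), an element of 𝕏^h with flux at least β₀ and norm at most some M
independent of h (`Hypothesis2.exists_mem_Xh`). Indeed δ times the flux of z is b(z, t) minus the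
two divergence terms, and these are already controlled by σ.

The analytic content is the bound M. The lifting is bounded in the norm of H^{-1/2}_{00}(Σ), this
norm is dominated by that of L²(Σ) (`exists_h00DualNorm_le`), R^h_D is a contraction, and ‖v_h·ν‖ is
bounded by the trace inequality `exists_norm_trace_le`. That inequality is proved for smooth
functions by integrating along the graph direction in a collar of the boundary
(`exists_local_trace_bound`), patched together by compactness and passed to the limit. It also makes
traces unique, so that the chosen value `trace` is the expected one and the flux is computable.

The projection R^h_D exists because Φ^h_D is closed (`HasStableLifting.isClosed_ΦD`). The linear
lifting shows this without knowing that a field has only one normal component in L²(Σ). -/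

/-! ## Graphs over hyperplanes -/

/-- Fubini along a unit vector `e` and its orthogonal hyperplane. -/
theorem lintegral_orthogonal_add_smul {e : E d} (he : ‖e‖ = 1) {h : E d → ℝ≥0∞}
    (hh : Measurable h) :
    ∫⁻ p : (ℝ ∙ e)ᗮ, ∫⁻ t : ℝ, h ((p : E d) + t • e) = ∫⁻ x, h x := by
  have h1 : MeasurePreserving ((ℝ ∙ e).measurableEquivProd (0 : E d)).symm volume volume := by
    have := (ℝ ∙ e).measurePreserving_measurableEquivProd (0 : E d)
    rw [InnerProductSpace.euclideanHausdorffMeasure_eq_volume] at this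
    exact this.symm
  -- As `e` is a unit vector, t ↦ t e is an isometry onto the line, so the inner integral may be
  -- taken over ℝ.
  have h2 := (LinearIsometryEquiv.toSpanUnitSingleton (𝕜 := ℝ) e he).measurePreserving
  have hm : Measurable fun q : (ℝ ∙ e) × (ℝ ∙ e)ᗮ => h ((q.1 : E d) + q.2) :=
    hh.comp (by fun_prop)
  rw [← h1.lintegral_comp hh]
  simp only [Submodule.measurableEquivProd_symm_apply, vadd_eq_add, add_zero]
  rw [Measure.volume_eq_prod, lintegral_prod_symm' _ hm]
  refine lintegral_congr fun p => ?_
  have hm' : Measurable fun x : (ℝ ∙ e) => h ((x : E d) + p) := hh.comp (by fun_prop)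
  rw [← h2.lintegral_comp hm']
  simp [add_comm]

/-- The surface measure on a Lipschitz graph is controlled by the Lebesgue measure of the
projection. -/
theorem exists_surf_restrict_graph_le {e : E d} (he : ‖e‖ = 1) {K : ℝ≥0} {f : E d → ℝ}
    (hf : LipschitzWith K f) (hfe : ∀ y (t : ℝ), f (y + t • e) = f y) :
    ∃ C : ℝ≥0, ∀ A : Set (E d), MeasurableSet A → (∀ y ∈ A, f y = ⟪e, y⟫) →
      (surf d).restrict A ≤
        C • Measure.map (fun p : (ℝ ∙ e)ᗮ => (p : E d) + f p • e) volume := by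
  set γ : (ℝ ∙ e)ᗮ → E d := fun p => (p : E d) + f p • e with hγ
  have hfK : LipschitzWith K fun p : (ℝ ∙ e)ᗮ => f p := by
    have := hf.comp (LipschitzWith.subtype_val ((ℝ ∙ e)ᗮ : Set (E d)))
    rwa [mul_one] at this
  have hLip : LipschitzWith (1 + K) γ := by
    refine (LipschitzWith.subtype_val ((ℝ ∙ e)ᗮ : Set (E d))).add ?_
    refine LipschitzWith.of_dist_le_mul fun p q => ?_
    rw [dist_eq_norm, ← sub_smul, norm_smul, he, mul_one, ← dist_eq_norm]
    exact hfK.dist_le_mul p q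
  have hdim : Module.finrank ℝ (ℝ ∙ e)ᗮ = d - 1 := by
    have h1 := (ℝ ∙ e).finrank_add_finrank_orthogonal
    have h2 : Module.finrank ℝ (ℝ ∙ e) = 1 :=
      finrank_span_singleton (by rintro rfl; simp at he)
    rw [h2, finrank_euclideanSpace_fin] at h1
    omega
  -- `γ` is Lipschitz with constant 1 + K, and a Lipschitz map enlarges (d-1)-dimensional Hausdorff
  -- measure at most by the (d-1)-st power of its constant.
  refine ⟨(1 + K) ^ (d - 1), fun A hA hAf => Measure.le_iff.mpr fun B hB => ?_⟩
  rw [Measure.restrict_apply hB, Measure.smul_apply, Measure.map_apply hLip.continuous.measurable hB]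
  have hsub : B ∩ A ⊆ γ '' (γ ⁻¹' B) := by
    rintro y ⟨hyB, hyA⟩
    have hmem : y - ⟪e, y⟫ • e ∈ (ℝ ∙ e)ᗮ := by
      rw [Submodule.mem_orthogonal_singleton_iff_inner_right, inner_sub_right,
        real_inner_smul_right, real_inner_self_eq_norm_sq, he]
      ring
    -- A point of the graph is recovered from its projection because `f` is constant in the
    -- direction `e`.
    have hy : γ ⟨y - ⟪e, y⟫ • e, hmem⟩ = y := by
      have h1 : f (y - ⟪e, y⟫ • e) = f y := by
        simpa [sub_eq_add_neg] using hfe y (-⟪e, y⟫)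
      simp only [hγ, h1, hAf y hyA]
      abel
    exact ⟨_, by simpa [hy] using hyB, hy⟩
  calc surf d (B ∩ A) ≤ surf d (γ '' (γ ⁻¹' B)) := measure_mono hsub
    _ ≤ ((1 + K : ℝ≥0) : ℝ≥0∞) ^ (d - 1) *
        (Measure.euclideanHausdorffMeasure (d - 1) : Measure (ℝ ∙ e)ᗮ) (γ ⁻¹' B) := by
      have := hLip.hausdorffMeasure_image_le (d := ((d - 1 : ℕ) : ℝ)) (by positivity) (γ ⁻¹' B)
      simp only [surf, Measure.euclideanHausdorffMeasure_def, Measure.smul_apply,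
        ENNReal.smul_def, smul_eq_mul]
      rw [ENNReal.rpow_natCast] at this
      calc _ ≤ _ := mul_le_mul_right this _
        _ = _ := by ring
    _ = _ := by
      rw [← hdim, InnerProductSpace.euclideanHausdorffMeasure_eq_volume]
      simp [ENNReal.smul_def]

/-- Integration over a collar above a piece of a Lipschitz graph. -/
theorem exists_lintegral_collar_le {e : E d} (he : ‖e‖ = 1) {K : ℝ≥0} {f : E d → ℝ}
    (hf : LipschitzWith K f) (hfe : ∀ y (t : ℝ), f (y + t • e) = f y) :
    ∃ C : ℝ≥0, ∀ (A O : Set (E d)) (δ : ℝ), MeasurableSet A → MeasurableSet O →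
      (∀ y ∈ A, f y = ⟪e, y⟫) → (∀ y ∈ A, ∀ t ∈ Set.Ioo 0 δ, y + t • e ∈ O) →
      ∀ h : E d → ℝ≥0∞, Measurable h →
      ∫⁻ y in A, (∫⁻ t in Set.Ioo 0 δ, h (y + t • e)) ∂(surf d) ≤ C * ∫⁻ x in O, h x := by
  obtain ⟨C, hC⟩ := exists_surf_restrict_graph_le he hf hfe
  refine ⟨C, fun A O δ hA hO hAf hAO h hh => ?_⟩
  have hcγ : Continuous fun p : (ℝ ∙ e)ᗮ => (p : E d) + f p • e := by
    have := hf.continuous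
    fun_prop
  have hk : Measurable fun y : E d => ∫⁻ t in Set.Ioo 0 δ, h (y + t • e) := by
    refine Measurable.lintegral_prod_right' (f := fun q : E d × ℝ => h (q.1 + q.2 • e)) ?_
    exact hh.comp (by fun_prop)
  -- The integral over `O` is sliced into lines parallel to `e`; each collar segment is part of such
  -- a line.
  rw [← lintegral_indicator hO, ← lintegral_orthogonal_add_smul he (hh.indicator hO)]
  calc ∫⁻ y in A, (∫⁻ t in Set.Ioo 0 δ, h (y + t • e)) ∂(surf d)
      = ∫⁻ y in A, A.indicator (fun y => ∫⁻ t in Set.Ioo 0 δ, h (y + t • e)) y ∂(surf d) := by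
        refine setLIntegral_congr_fun hA fun y hy => ?_
        rw [Set.indicator_of_mem hy]
    _ ≤ ∫⁻ y, A.indicator (fun y => ∫⁻ t in Set.Ioo 0 δ, h (y + t • e)) y
          ∂(C • Measure.map (fun p : (ℝ ∙ e)ᗮ => (p : E d) + f p • e) volume) :=
        lintegral_mono' (hC A hA hAf) le_rfl
    _ = C * ∫⁻ p : (ℝ ∙ e)ᗮ, A.indicator (fun y => ∫⁻ t in Set.Ioo 0 δ, h (y + t • e))
          ((p : E d) + f p • e) := by
        rw [lintegral_smul_measure, lintegral_map (hk.indicator hA) hcγ.measurable]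
        rfl
    _ ≤ C * ∫⁻ p : (ℝ ∙ e)ᗮ, ∫⁻ t : ℝ, O.indicator h ((p : E d) + t • e) := by
        gcongr with p
        -- Translating by `f p` makes t the height above the graph instead of the height above the
        -- hyperplane.
        rw [← lintegral_add_left_eq_self (fun t : ℝ => O.indicator h ((p : E d) + t • e)) (f p)]
        by_cases hp : (p : E d) + f p • e ∈ A
        · rw [Set.indicator_of_mem hp, ← lintegral_indicator measurableSet_Ioo]
          refine lintegral_mono fun t => ?_
          by_cases ht : t ∈ Set.Ioo 0 δ
          · have := hAO _ hp t ht
            rw [Set.indicator_of_mem ht, add_smul, ← add_assoc, Set.indicator_of_mem this]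
          · simp [Set.indicator_of_notMem ht]
        · simp [Set.indicator_of_notMem hp]

/-! ## The trace inequality for smooth functions -/

theorem sq_lintegral_Ioo_le {δ : ℝ} {f : ℝ → ℝ≥0∞} (hf : AEMeasurable f) :
    (∫⁻ t in Set.Ioo 0 δ, f t) ^ 2 ≤ ENNReal.ofReal δ * ∫⁻ t in Set.Ioo 0 δ, f t ^ 2 := by
  have h := ENNReal.lintegral_mul_le_Lp_mul_Lq ((volume : Measure ℝ).restrict (Set.Ioo 0 δ))
    Real.HolderConjugate.two_two hf.restrict (aemeasurable_const (b := (1 : ℝ≥0∞)))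
  have h' := pow_le_pow_left' h 2
  rw [mul_pow, ← ENNReal.rpow_natCast, ← ENNReal.rpow_natCast, ← ENNReal.rpow_natCast,
    ← ENNReal.rpow_mul, ← ENNReal.rpow_mul] at h'
  simpa [mul_comm] using h'

theorem add_sq_le_two_mul (a b : ℝ≥0∞) : (a + b) ^ 2 ≤ 2 * a ^ 2 + 2 * b ^ 2 := by
  have h := ENNReal.rpow_add_le_mul_rpow_add_rpow a b (p := 2) (by norm_num)
  norm_num at h
  rwa [mul_add] at h

/-- By the fundamental theorem of calculus, v(y) is v(y + t e) minus the integral of the derivative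
along the segment. Squaring and integrating over t in (0, δ) replaces the boundary value by
integrals over the segment; Cauchy–Schwarz supplies the second factor δ. -/
theorem enorm_sq_le_add_lintegral_fderiv [CompleteSpace F] {v : E d → F} (hv : ContDiff ℝ ∞ v)
    (e y : E d) (δ : ℝ) :
    ENNReal.ofReal δ * ‖v y‖ₑ ^ 2 ≤
      2 * (∫⁻ t in Set.Ioo 0 δ, ‖v (y + t • e)‖ₑ ^ 2)
        + 2 * ENNReal.ofReal δ ^ 2 * ∫⁻ t in Set.Ioo 0 δ, ‖fderiv ℝ v (y + t • e) e‖ₑ ^ 2 := by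
  have hder : ∀ t : ℝ, HasDerivAt (fun t : ℝ => v (y + t • e)) (fderiv ℝ v (y + t • e) e) t := by
    intro t
    have h1 : HasDerivAt (fun t : ℝ => y + t • e) e t := by
      simpa using ((hasDerivAt_id t).smul_const e).const_add y
    exact ((hv.differentiable (by simp) _).hasFDerivAt).comp_hasDerivAt t h1
  have hcont : Continuous fun t : ℝ => fderiv ℝ v (y + t • e) e :=
    ((hv.continuous_fderiv (by simp)).comp (by fun_prop)).clm_apply continuous_const
  set I : ℝ≥0∞ := ∫⁻ t in Set.Ioo 0 δ, ‖fderiv ℝ v (y + t • e) e‖ₑ with hI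
  have hpt : ∀ t ∈ Set.Ioo 0 δ, ‖v y‖ₑ ^ 2 ≤ 2 * ‖v (y + t • e)‖ₑ ^ 2 + 2 * I ^ 2 := by
    intro t ht
    have h1 := intervalIntegral.integral_eq_sub_of_hasDerivAt (a := 0) (b := t)
      (fun s _ => hder s) (hcont.intervalIntegrable _ _)
    have h2 : v y = v (y + t • e) - ∫ s in (0 : ℝ)..t, fderiv ℝ v (y + s • e) e := by
      rw [h1]; simp
    -- Enlarging the interval to (0, δ) gives a bound that no longer depends on t.
    have h3 : ‖∫ s in (0 : ℝ)..t, fderiv ℝ v (y + s • e) e‖ₑ ≤ I := by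
      rw [intervalIntegral.integral_of_le ht.1.le]
      refine (enorm_integral_le_lintegral_enorm _).trans (lintegral_mono_set fun s hs => ?_)
      exact ⟨hs.1, hs.2.trans_lt ht.2⟩
    calc ‖v y‖ₑ ^ 2 ≤ (‖v (y + t • e)‖ₑ + I) ^ 2 := by
          rw [h2]
          gcongr
          exact enorm_sub_le.trans (by gcongr)
      _ ≤ _ := add_sq_le_two_mul _ _
  calc ENNReal.ofReal δ * ‖v y‖ₑ ^ 2 = ∫⁻ _ in Set.Ioo 0 δ, ‖v y‖ₑ ^ 2 := by
        simp [mul_comm]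
    _ ≤ ∫⁻ t in Set.Ioo 0 δ, (2 * ‖v (y + t • e)‖ₑ ^ 2 + 2 * I ^ 2) :=
        setLIntegral_mono' measurableSet_Ioo hpt
    _ = 2 * (∫⁻ t in Set.Ioo 0 δ, ‖v (y + t • e)‖ₑ ^ 2) + 2 * ENNReal.ofReal δ * I ^ 2 := by
        rw [lintegral_add_right _ measurable_const, lintegral_const_mul' _ _ (by simp)]
        simp
        ring
    _ ≤ _ := by
        have := sq_lintegral_Ioo_le (δ := δ) hcont.enorm.measurable.aemeasurable
        refine add_le_add_right ?_ _
        rw [sq (ENNReal.ofReal δ), ← mul_assoc, mul_assoc (2 * ENNReal.ofReal δ)]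
        exact mul_le_mul_right this _

/-- In a boundary chart, each boundary point is the foot of a segment of length δ inside `O`. The
one-dimensional estimate on these segments, integrated over the boundary piece, becomes an integral
over `O` by the collar inequality. -/
theorem exists_local_trace_bound {O : Set (E d)} (hO : IsOpen O) (hL : HasLipschitzBoundary O)
    (F : Type) [NormedAddCommGroup F] [NormedSpace ℝ F] [CompleteSpace F] {x : E d}
    (hx : x ∈ frontier O) :
    ∃ ρ > 0, ∃ C : ℝ≥0, ∀ v : E d → F, ContDiff ℝ ∞ v →
      ∫⁻ y in frontier O ∩ Metric.ball x ρ, ‖v y‖ₑ ^ 2 ∂(surf d) ≤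
        C * ((∫⁻ y in O, ‖v y‖ₑ ^ 2) + ∫⁻ y in O, ‖fderiv ℝ v y‖ₑ ^ 2) := by
  obtain ⟨e, r, K, f, he, hr, hf, hfe, hgraph⟩ := hL x hx
  obtain ⟨C, hC⟩ := exists_lintegral_collar_le he hf hfe
  have hee : ⟪e, e⟫ = 1 := by rw [real_inner_self_eq_norm_sq, he]; norm_num
  -- Half the chart radius serves both as radius of the boundary piece and as length of the
  -- segments, so the collar stays in the chart.
  set δ : ℝ := r / 2 with hδ
  have hδ0 : 0 < δ := by positivity
  set A := frontier O ∩ Metric.ball x δ with hA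
  have hAr : ∀ y ∈ A, y ∈ Metric.ball x r := fun y hy =>
    Metric.ball_subset_ball (by linarith) hy.2
  -- A boundary point is not above the graph, since `O` is open, nor strictly below it, where a
  -- whole neighbourhood would miss `O`.
  have hAf : ∀ y ∈ A, f y = ⟪e, y⟫ := by
    intro y hy
    have hcf := hf.continuous
    have hyO : y ∉ O := by
      have := hy.1
      rw [hO.frontier_eq] at this
      exact this.2
    rcases lt_trichotomy (f y) ⟪e, y⟫ with h | h | h
    · exact absurd ((hgraph y (hAr y hy)).mpr h) hyO
    · exact h
    · exfalso
      have h1 : ∀ᶠ z in 𝓝 y, ⟪e, z⟫ < f z :=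
        (by fun_prop : Continuous fun z : E d => ⟪e, z⟫).continuousAt.eventually_lt
          hcf.continuousAt h
      have h2 : ∃ᶠ z in 𝓝 y, z ∈ O := mem_closure_iff_frequently.mp hy.1.1
      obtain ⟨z, hzO, hz1, hz2⟩ :=
        (h2.and_eventually (h1.and (Metric.isOpen_ball.mem_nhds (hAr y hy)))).exists
      have := (hgraph z hz2).mp hzO
      linarith
  have hAO : ∀ y ∈ A, ∀ t ∈ Set.Ioo 0 δ, y + t • e ∈ O := by
    intro y hy t ht
    refine (hgraph _ ?_).mpr ?_
    · have h1 : dist (y + t • e) x ≤ dist y x + t := by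
        rw [dist_eq_norm, dist_eq_norm, add_sub_right_comm]
        refine (norm_add_le _ _).trans ?_
        rw [norm_smul, he, mul_one, Real.norm_of_nonneg ht.1.le]
      have h2 : dist y x < δ := hy.2
      have h3 := ht.2
      rw [Metric.mem_ball]
      linarith
    · rw [hfe, hAf y hy, inner_add_right, real_inner_smul_right, hee]
      linarith [ht.1]
  have hAm : MeasurableSet A := isClosed_frontier.measurableSet.inter measurableSet_ball
  set D : ℝ≥0 := δ.toNNReal with hD
  have hDpos : D ≠ 0 := by simpa [hD] using hδ0
  refine ⟨δ, hδ0, D⁻¹ * (2 * C + 2 * D ^ 2 * C), fun v hv => ?_⟩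
  have hcv : Continuous v := hv.continuous
  have hcd : Continuous (fderiv ℝ v) := hv.continuous_fderiv (by simp)
  set a : ℝ≥0∞ := ∫⁻ y in O, ‖v y‖ₑ ^ 2
  set b : ℝ≥0∞ := ∫⁻ y in O, ‖fderiv ℝ v y‖ₑ ^ 2
  have hm1 : Measurable fun y : E d => ∫⁻ t in Set.Ioo 0 δ, ‖v (y + t • e)‖ₑ ^ 2 := by
    refine Measurable.lintegral_prod_right' (f := fun q : E d × ℝ => ‖v (q.1 + q.2 • e)‖ₑ ^ 2) ?_
    exact Continuous.measurable (by fun_prop)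
  have hA1 := hC A O δ hAm hO.measurableSet hAf hAO (fun y => ‖v y‖ₑ ^ 2)
    (Continuous.measurable (by fun_prop))
  have hA2 := hC A O δ hAm hO.measurableSet hAf hAO (fun y => ‖fderiv ℝ v y‖ₑ ^ 2)
    (Continuous.measurable (by fun_prop))
  have key : (D : ℝ≥0∞) * ∫⁻ y in A, ‖v y‖ₑ ^ 2 ∂(surf d) ≤
      (2 * C + 2 * D ^ 2 * C) * (a + b) := by
    calc (D : ℝ≥0∞) * ∫⁻ y in A, ‖v y‖ₑ ^ 2 ∂(surf d)
        = ∫⁻ y in A, D * ‖v y‖ₑ ^ 2 ∂(surf d) := (lintegral_const_mul' _ _ (by simp)).symm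
      _ ≤ ∫⁻ y in A, (2 * (∫⁻ t in Set.Ioo 0 δ, ‖v (y + t • e)‖ₑ ^ 2)
          + 2 * D ^ 2 * ∫⁻ t in Set.Ioo 0 δ, ‖fderiv ℝ v (y + t • e)‖ₑ ^ 2) ∂(surf d) := by
          refine lintegral_mono fun y => (enorm_sq_le_add_lintegral_fderiv hv e y δ).trans ?_
          gcongr with t
          · exact le_rfl
          · simpa [he, ← ofReal_norm] using
              ENNReal.ofReal_le_ofReal ((fderiv ℝ v (y + t • e)).le_opNorm e)
      _ ≤ 2 * (C * a) + 2 * D ^ 2 * (C * b) := by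
          rw [lintegral_add_left (hm1.const_mul _), lintegral_const_mul' _ _ (by simp),
            lintegral_const_mul' _ _ (by finiteness)]
          gcongr
      -- The missing cross terms are added so that a + b factors out.
      _ ≤ 2 * (C * a) + 2 * D ^ 2 * (C * b) + (2 * (C * b) + 2 * D ^ 2 * (C * a)) :=
          le_self_add
      _ = _ := by ring
  push_cast [ENNReal.coe_inv hDpos]
  rw [mul_assoc, ← ENNReal.mul_le_iff_le_inv (by simpa using hDpos) (by simp)]
  exact key

/-- The trace inequality for smooth functions on a bounded Lipschitz domain. -/
theorem exists_trace_bound {O : Set (E d)} (hO : IsLipschitzPolyhedral O) (F : Type)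
    [NormedAddCommGroup F] [NormedSpace ℝ F] [CompleteSpace F] :
    ∃ C : ℝ≥0, ∀ v : E d → F, ContDiff ℝ ∞ v →
      eLpNorm v 2 ((surf d).restrict (frontier O)) ≤
        C * (eLpNorm v 2 (volume.restrict O) +
          ∑ j, eLpNorm (fun x => fderiv ℝ v x (coordVec j)) 2 (volume.restrict O)) := by
  have hsq : ∀ {G : Type} [NormedAddCommGroup G] (μ : Measure (E d)) (v : E d → G),
      eLpNorm v 2 μ ^ 2 = ∫⁻ y, ‖v y‖ₑ ^ 2 ∂μ := by
    intro G _ μ v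
    simpa using eLpNorm_nnreal_pow_eq_lintegral (f := v) (μ := μ) (p := 2) (by norm_num)
  have hcpt : IsCompact (frontier O) :=
    Metric.isCompact_of_isClosed_isBounded isClosed_frontier
      (hO.isBounded.closure.subset frontier_subset_closure)
  have hcov : ∃ C : ℝ≥0, ∀ v : E d → F, ContDiff ℝ ∞ v →
      ∫⁻ y in frontier O ∩ frontier O, ‖v y‖ₑ ^ 2 ∂(surf d) ≤
        C * ((∫⁻ y in O, ‖v y‖ₑ ^ 2) + ∫⁻ y in O, ‖fderiv ℝ v y‖ₑ ^ 2) := by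
    -- The estimate on a part S of the boundary passes to subsets and finite unions, so by
    -- compactness the local estimates suffice.
    refine hcpt.induction_on (p := fun S => ∃ C : ℝ≥0, ∀ v : E d → F, ContDiff ℝ ∞ v →
      ∫⁻ y in frontier O ∩ S, ‖v y‖ₑ ^ 2 ∂(surf d) ≤
        C * ((∫⁻ y in O, ‖v y‖ₑ ^ 2) + ∫⁻ y in O, ‖fderiv ℝ v y‖ₑ ^ 2)) ?_ ?_ ?_ ?_
    · exact ⟨0, by simp⟩
    · rintro S T hST ⟨C, hC⟩
      exact ⟨C, fun v hv => (lintegral_mono_set (Set.inter_subset_inter_right _ hST)).trans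
        (hC v hv)⟩
    · rintro S T ⟨C, hC⟩ ⟨C', hC'⟩
      refine ⟨C + C', fun v hv => ?_⟩
      rw [Set.inter_union_distrib_left, ENNReal.coe_add, add_mul]
      exact (lintegral_union_le _ _ _).trans (add_le_add (hC v hv) (hC' v hv))
    · intro x hx
      obtain ⟨ρ, hρ, C, hC⟩ := exists_local_trace_bound hO.isOpen hO.lipschitz F hx
      exact ⟨_, mem_nhdsWithin_of_mem_nhds (Metric.ball_mem_nhds x hρ), C, hC⟩
  obtain ⟨C, hC⟩ := hcov
  -- The squared estimate yields the constant √C, using a² + b² ≤ (a + b)².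
  refine ⟨NNReal.sqrt C, fun v hv => ?_⟩
  have hcd : ∀ j, Continuous fun x => fderiv ℝ v x (coordVec j) := fun j =>
    (hv.continuous_fderiv (by simp)).clm_apply continuous_const
  have h1 : eLpNorm (fderiv ℝ v) 2 (volume.restrict O) ≤
      ∑ j, eLpNorm (fun x => fderiv ℝ v x (coordVec j)) 2 (volume.restrict O) := by
    calc eLpNorm (fderiv ℝ v) 2 (volume.restrict O)
        ≤ eLpNorm (∑ j, fun x => ‖fderiv ℝ v x (coordVec j)‖) 2 (volume.restrict O) := by
          refine eLpNorm_mono_real fun x => ?_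
          rw [Finset.sum_apply]
          refine ContinuousLinearMap.opNorm_le_bound _ (by positivity) fun z => ?_
          have hz : z = ∑ j, z j • coordVec j := by
            have := (EuclideanSpace.basisFun (Fin d) ℝ).sum_repr z
            simpa [coordVec] using this.symm
          conv_lhs => rw [hz]
          rw [map_sum, Finset.sum_mul]
          refine (norm_sum_le _ _).trans (Finset.sum_le_sum fun j _ => ?_)
          rw [map_smul, norm_smul, mul_comm]
          gcongr
          exact PiLp.norm_apply_le z j
      _ ≤ ∑ j, eLpNorm (fun x => ‖fderiv ℝ v x (coordVec j)‖) 2 (volume.restrict O) :=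
          eLpNorm_sum_le (fun j _ => (hcd j).norm.aestronglyMeasurable) (by norm_num)
      _ = _ := by simp only [eLpNorm_norm]
  have h2 := hC v hv
  rw [Set.inter_self, ← hsq, ← hsq, ← hsq] at h2
  have h3 : eLpNorm v 2 ((surf d).restrict (frontier O)) ^ 2 ≤
      (NNReal.sqrt C * (eLpNorm v 2 (volume.restrict O)
        + eLpNorm (fderiv ℝ v) 2 (volume.restrict O))) ^ 2 := by
    refine h2.trans ?_
    rw [mul_pow, ← ENNReal.coe_pow, NNReal.sq_sqrt]
    gcongr
    rw [add_sq']
    exact le_self_add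
  have h4 := (ENNReal.pow_le_pow_left_iff two_ne_zero).mp h3
  exact h4.trans (by gcongr)

/-! ## Weak derivatives -/

/-- Uniqueness of weak partial derivatives on open sets. -/
theorem HasWeakPartial.unique [CompleteSpace F] {O : Set (E d)} (hO : IsOpen O) {j : Fin d}
    {u g g' : L2 O F} (h : HasWeakPartial O j u g) (h' : HasWeakPartial O j u g') : g = g' := by
  have hloc : LocallyIntegrableOn (fun x => g x - g' x) O (volume : Measure (E d)) := by
    have h2 : MemLp (fun x => g x - g' x) 2 ((volume : Measure (E d)).restrict O) :=
      (Lp.memLp g).sub (Lp.memLp g')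
    have h3 := h2.locallyIntegrable (by norm_num)
    rw [locallyIntegrableOn_iff hO.isLocallyClosed]
    intro k hk hkc
    have := h3.integrableOn_isCompact hkc
    rwa [IntegrableOn, Measure.restrict_restrict hkc.measurableSet,
      Set.inter_eq_left.mpr hk] at this
  have key := hO.ae_eq_zero_of_integral_contDiff_smul_eq_zero hloc (by
    intro φ h1 h2 h3
    have ht : IsTest O φ := ⟨h1, h2, h3⟩
    have e := neg_injective ((h φ ht).symm.trans (h' φ ht))
    have e2 : ∫ x in O, φ x • (g x - g' x) = 0 := by
      simp only [smul_sub]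
      rw [integral_sub (integrable_test_smul ht g) (integrable_test_smul ht g'), e, sub_self]
    rw [← e2, setIntegral_eq_integral_of_forall_compl_eq_zero]
    intro x hx
    have : φ x = 0 := image_eq_zero_of_notMem_tsupport fun hx' => hx (h3 hx')
    simp [this])
  refine Lp.ext ?_
  filter_upwards [(ae_restrict_iff' hO.measurableSet).mpr key] with x hx
  exact sub_eq_zero.mp hx

theorem weakPartial_eq [CompleteSpace F] {O : Set (E d)} (hO : IsOpen O) {j : Fin d}
    {u g : L2 O F} (h : HasWeakPartial O j u g) : weakPartial O j u = g := by
  have hex : ∃ g, HasWeakPartial O j u g := ⟨g, h⟩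
  rw [weakPartial, dif_pos hex]
  exact hex.choose_spec.unique hO h

theorem hasWeakPartial_weakPartial {O : Set (E d)} {u : L2 O F} (hu : u ∈ H1 O F) (j : Fin d) :
    HasWeakPartial O j u (weakPartial O j u) := by
  rw [weakPartial, dif_pos (hu j)]
  exact (hu j).choose_spec

theorem h1Norm_nonneg {O : Set (E d)} (u : L2 O F) : 0 ≤ h1Norm u := Real.sqrt_nonneg _

theorem hdivNorm_nonneg {O : Set (E d)} (u : L2 O (E d)) : 0 ≤ hdivNorm u := Real.sqrt_nonneg _

theorem norm_le_h1Norm {O : Set (E d)} (u : L2 O F) : ‖u‖ ≤ h1Norm u :=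
  Real.le_sqrt_of_sq_le (le_add_of_nonneg_right (by positivity))

theorem norm_weakPartial_le_h1Norm {O : Set (E d)} (u : L2 O F) (j : Fin d) :
    ‖weakPartial O j u‖ ≤ h1Norm u := by
  refine Real.le_sqrt_of_sq_le (le_add_of_nonneg_of_le (by positivity) ?_)
  exact Finset.single_le_sum (f := fun j => ‖weakPartial O j u‖ ^ 2) (fun _ _ => by positivity)
    (Finset.mem_univ j)

theorem norm_le_hdivNorm {O : Set (E d)} (u : L2 O (E d)) : ‖u‖ ≤ hdivNorm u :=
  Real.le_sqrt_of_sq_le (le_add_of_nonneg_right (by positivity))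

theorem norm_weakDiv_le_hdivNorm {O : Set (E d)} (u : L2 O (E d)) :
    ‖weakDiv O u‖ ≤ hdivNorm u :=
  Real.le_sqrt_of_sq_le (le_add_of_nonneg_left (by positivity))

theorem h1Norm_neg [CompleteSpace F] {O : Set (E d)} (hO : IsOpen O) {u : L2 O F}
    (hu : u ∈ H1 O F) : h1Norm (-u) = h1Norm u := by
  have h : ∀ j, weakPartial O j (-u) = -weakPartial O j u := fun j => by
    have := (hasWeakPartial_weakPartial hu j).smul (-1)
    rw [neg_one_smul, neg_one_smul] at this
    exact weakPartial_eq hO this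
  simp [h1Norm, h]

theorem h1Norm_zero [CompleteSpace F] {O : Set (E d)} (hO : IsOpen O) :
    h1Norm (0 : L2 O F) = 0 := by
  simp [h1Norm, weakPartial_eq hO (HasWeakPartial.zero (F := F) (O := O))]

theorem weakDiv_neg {O : Set (E d)} (hO : IsOpen O) {u : L2 O (E d)} (hu : u ∈ Hdiv O) :
    weakDiv O (-u) = -weakDiv O u := by
  simpa using weakDiv_smul hO (-1) hu

theorem hdivNorm_neg {O : Set (E d)} (hO : IsOpen O) {u : L2 O (E d)} (hu : u ∈ Hdiv O) :
    hdivNorm (-u) = hdivNorm u := by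
  simp [hdivNorm, weakDiv_neg hO hu]

theorem hdivNorm_zero {O : Set (E d)} (hO : IsOpen O) : hdivNorm (0 : L2 O (E d)) = 0 := by
  simp [hdivNorm, weakDiv_zero hO]

/-- The weak divergence of an `H¹` field is the trace of its weak gradient. -/
theorem hasWeakDiv_sum_weakPartial {O : Set (E d)} {u : L2 O (E d)} (hu : u ∈ H1 O (E d)) :
    HasWeakDiv O u (∑ j, (EuclideanSpace.proj j : E d →L[ℝ] ℝ).compLp (weakPartial O j u)) := by
  intro φ hφ
  have e2 : ∫ x in O, φ x •
        (∑ j, (EuclideanSpace.proj j : E d →L[ℝ] ℝ).compLp (weakPartial O j u) : L2 O ℝ) x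
      = ∫ x in O, ∑ j, (φ x • weakPartial O j u x) j := by
    refine integral_congr_ae ?_
    filter_upwards [Lp.coeFn_finsetSum Finset.univ
      (fun j => (EuclideanSpace.proj j : E d →L[ℝ] ℝ).compLp (weakPartial O j u)),
      eventually_all.mpr fun j => (EuclideanSpace.proj j : E d →L[ℝ] ℝ).coeFn_compLp
        (weakPartial O j u)] with x hx hx'
    rw [hx, Finset.sum_apply, Finset.smul_sum]
    refine Finset.sum_congr rfl fun j _ => ?_
    rw [hx' j]
    rfl
  have e1 : ∫ x in O, fderiv ℝ φ x (u x)
      = ∫ x in O, ∑ j, (fderiv ℝ φ x (coordVec j) • u x) j := by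
    refine integral_congr_ae (Eventually.of_forall fun x => ?_)
    simp only [fderiv_apply_eq_sum φ x (u x), PiLp.smul_apply]
  have hc : ∀ (j : Fin d) {k : E d → E d}, Integrable k ((volume : Measure (E d)).restrict O) →
      Integrable (fun x => k x j) ((volume : Measure (E d)).restrict O) ∧
      ∫ x in O, k x j = (∫ x in O, k x) j := fun j k hk =>
    ⟨(EuclideanSpace.proj j : E d →L[ℝ] ℝ).integrable_comp hk,
      (EuclideanSpace.proj j : E d →L[ℝ] ℝ).integral_comp_comm hk⟩
  rw [e1, e2, integral_finsetSum _ fun j _ => (hc j (integrable_fderiv_smul hφ j u)).1,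
    integral_finsetSum _ fun j _ => (hc j (integrable_test_smul hφ (weakPartial O j u))).1,
    ← Finset.sum_neg_distrib]
  refine Finset.sum_congr rfl fun j _ => ?_
  rw [(hc j (integrable_fderiv_smul hφ j u)).2,
    (hc j (integrable_test_smul hφ (weakPartial O j u))).2,
    hasWeakPartial_weakPartial hu j φ hφ]
  rfl

theorem H1_le_Hdiv (O : Set (E d)) : H1 O (E d) ≤ Hdiv O :=
  fun _ hu => ⟨_, hasWeakDiv_sum_weakPartial hu⟩

/-- The factor d counts the diagonal derivatives, each bounded by the full norm; a sharper constant
is not needed. -/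
theorem norm_weakDiv_le_h1Norm {O : Set (E d)} (hO : IsOpen O) {u : L2 O (E d)}
    (hu : u ∈ H1 O (E d)) : ‖weakDiv O u‖ ≤ d * h1Norm u := by
  rw [weakDiv_eq hO (hasWeakDiv_sum_weakPartial hu)]
  have h : ∀ j ∈ Finset.univ, ‖(EuclideanSpace.proj j : E d →L[ℝ] ℝ).compLp (weakPartial O j u)‖
      ≤ h1Norm u := by
    intro j _
    refine le_trans ?_ (norm_weakPartial_le_h1Norm u j)
    refine Lp.norm_le_norm_of_ae_le ?_
    filter_upwards [(EuclideanSpace.proj j : E d →L[ℝ] ℝ).coeFn_compLp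
      (weakPartial O j u)] with x hx
    rw [hx]
    exact PiLp.norm_apply_le _ j
  simpa using (norm_sum_le _ _).trans (Finset.sum_le_sum h)

/-! ## Continuity of the trace -/

theorem eLpNorm_le_eLpNorm_sub_add {F : Type} [NormedAddCommGroup F] {μ : Measure (E d)} {v f : E d → F}
    (hv : AEStronglyMeasurable v μ) (hf : AEStronglyMeasurable f μ) :
    eLpNorm v 2 μ ≤ eLpNorm (fun x => v x - f x) 2 μ + eLpNorm f 2 μ ∧
      eLpNorm f 2 μ ≤ eLpNorm (fun x => v x - f x) 2 μ + eLpNorm v 2 μ := by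
  have h1 := eLpNorm_add_le (hv.sub hf) hf (p := 2) (by norm_num)
  have h2 := eLpNorm_sub_le hv (hv.sub hf) (p := 2) (by norm_num)
  rw [sub_add_cancel] at h1
  rw [sub_sub_cancel, add_comm] at h2
  exact ⟨h1, h2⟩

/-- The inequality for smooth functions survives the limit because a trace is by definition a limit
of smooth boundary values along a sequence converging in H¹. -/
theorem HasTrace.eLpNorm_le {O : Set (E d)} {C : ℝ≥0}
    (hC : ∀ v : E d → F, ContDiff ℝ ∞ v → eLpNorm v 2 ((surf d).restrict (frontier O)) ≤
        C * (eLpNorm v 2 (volume.restrict O) +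
          ∑ j, eLpNorm (fun x => fderiv ℝ v x (coordVec j)) 2 (volume.restrict O)))
    {w : L2 O F} {g : L2Surf (frontier O) F} {G : Fin d → L2 O F} {v : ℕ → E d → F}
    (hv : ∀ n, ContDiff ℝ ∞ (v n))
    (h1 : Tendsto (fun n => eLpNorm (fun x => v n x - w x) 2
      ((volume : Measure (E d)).restrict O)) atTop (𝓝 0))
    (h2 : ∀ j, Tendsto (fun n => eLpNorm (fun x => fderiv ℝ (v n) x (coordVec j) - G j x) 2
        ((volume : Measure (E d)).restrict O)) atTop (𝓝 0))
    (h3 : Tendsto (fun n => eLpNorm (fun x => v n x - g x) 2 ((surf d).restrict (frontier O)))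
        atTop (𝓝 0)) :
    eLpNorm g 2 ((surf d).restrict (frontier O)) ≤
      C * (eLpNorm w 2 (volume.restrict O) + ∑ j, eLpNorm (G j) 2 (volume.restrict O)) := by
  have hlim : Tendsto (fun n => eLpNorm (fun x => v n x - g x) 2 ((surf d).restrict (frontier O))
      + C * ((eLpNorm (fun x => v n x - w x) 2 (volume.restrict O)
          + eLpNorm w 2 (volume.restrict O))
        + ∑ j, (eLpNorm (fun x => fderiv ℝ (v n) x (coordVec j) - G j x) 2 (volume.restrict O)
          + eLpNorm (G j) 2 (volume.restrict O)))) atTop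
      (𝓝 (0 + C * ((0 + eLpNorm w 2 (volume.restrict O))
        + ∑ j, (0 + eLpNorm (G j) 2 (volume.restrict O))))) := by
    refine h3.add (ENNReal.Tendsto.const_mul ?_ (Or.inr (by simp)))
    exact (h1.add_const _).add (tendsto_finsetSum _ fun j _ => (h2 j).add_const _)
  simp only [zero_add] at hlim
  refine ge_of_tendsto' hlim fun n => ?_
  have hvc := (hv n).continuous
  have hdc : ∀ j, Continuous fun x => fderiv ℝ (v n) x (coordVec j) := fun j =>
    ((hv n).continuous_fderiv (by simp)).clm_apply continuous_const
  refine (eLpNorm_le_eLpNorm_sub_add hvc.aestronglyMeasurable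
    (Lp.aestronglyMeasurable g)).2.trans ?_
  gcongr
  refine (hC (v n) (hv n)).trans ?_
  gcongr with j
  · exact (eLpNorm_le_eLpNorm_sub_add hvc.aestronglyMeasurable (Lp.aestronglyMeasurable w)).1
  · exact (eLpNorm_le_eLpNorm_sub_add (hdc j).aestronglyMeasurable
      (Lp.aestronglyMeasurable (G j))).1

/-- The trace inequality `‖w‖_{L²(∂O)} ≤ C ‖w‖_{H¹(O)}`. -/
theorem exists_norm_trace_le {O : Set (E d)} (hO : IsLipschitzPolyhedral O) (F : Type)
    [NormedAddCommGroup F] [NormedSpace ℝ F] [CompleteSpace F] :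
    ∃ C > 0, ∀ (w : L2 O F) (g : L2Surf (frontier O) F), HasTrace O w g →
      ‖g‖ ≤ C * h1Norm w := by
  obtain ⟨C, hC⟩ := exists_trace_bound hO F
  -- `C + 1` makes the constant strictly positive; 1 + d counts the function and its partial
  -- derivatives.
  refine ⟨(C + 1) * (1 + d), by positivity, fun w g h => ?_⟩
  obtain ⟨G, hG, v, hv, h1, h2, h3⟩ := h
  have hle := HasTrace.eLpNorm_le hC hv h1 h2 h3
  have hfin : ∀ j, eLpNorm (G j) 2 (volume.restrict O) ≠ ⊤ := fun j => (Lp.memLp (G j)).2.ne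
  have hfw : eLpNorm w 2 (volume.restrict O) ≠ ⊤ := (Lp.memLp w).2.ne
  have hsum : ∑ j, eLpNorm (G j) 2 (volume.restrict O) ≠ ⊤ :=
    ENNReal.sum_ne_top.mpr fun j _ => hfin j
  have hr := ENNReal.toReal_mono (by finiteness) hle
  rw [ENNReal.toReal_mul, ENNReal.toReal_add hfw hsum, ENNReal.toReal_sum fun j _ => hfin j,
    ENNReal.coe_toReal] at hr
  simp only [← Lp.norm_def] at hr
  have hGj : ∑ j, ‖G j‖ ≤ d * h1Norm w := by
    have : ∀ j ∈ Finset.univ, ‖G j‖ ≤ h1Norm w := fun j _ => by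
      rw [← weakPartial_eq hO.isOpen (hG j)]
      exact norm_weakPartial_le_h1Norm w j
    simpa using Finset.sum_le_sum this
  calc ‖g‖ ≤ C * (‖w‖ + ∑ j, ‖G j‖) := hr
    _ ≤ (C + 1) * (h1Norm w + d * h1Norm w) := by
        gcongr
        · simp
        · exact norm_le_h1Norm w
    _ = _ := by ring

/-- The difference of two traces of the same function is a trace of 0, and the trace inequality
makes it vanish. -/
theorem HasTrace.unique [CompleteSpace F] [SecondCountableTopology F] {O : Set (E d)}
    (hO : IsLipschitzPolyhedral O) {w : L2 O F} {g g' : L2Surf (frontier O) F}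
    (h : HasTrace O w g) (h' : HasTrace O w g') : g = g' := by
  obtain ⟨C, _, hC⟩ := exists_norm_trace_le hO F
  have h1 := h.add (h'.smul (-1))
  rw [neg_one_smul, neg_one_smul, add_neg_cancel, ← sub_eq_add_neg] at h1
  have h2 := hC _ _ h1
  rw [h1Norm_zero hO.isOpen, mul_zero] at h2
  exact sub_eq_zero.mp (norm_le_zero_iff.mp h2)

theorem trace_eq [CompleteSpace F] [SecondCountableTopology F] {O : Set (E d)}
    (hO : IsLipschitzPolyhedral O) {w : L2 O F} {g : L2Surf (frontier O) F}
    (h : HasTrace O w g) : trace O w = g := by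
  have hex : ∃ g, HasTrace O w g := ⟨g, h⟩
  rw [trace, dif_pos hex]
  exact hex.choose_spec.unique hO h

theorem VanishesOn.eq_zero {F : Type} [NormedAddCommGroup F] {O : Set (E d)} {g : L2Surf (frontier O) F}
    (h : VanishesOn g (frontier O)) : g = 0 := by
  refine Lp.ext ?_
  filter_upwards [h, ae_restrict_mem isClosed_frontier.measurableSet,
    Lp.coeFn_zero F 2 ((surf d).restrict (frontier O))] with x h1 h2 h3
  rw [h1 h2, h3, Pi.zero_apply]

/-- This is the trace inequality for the constant function 1, which has no gradient and is square
integrable on a bounded set. -/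
theorem IsLipschitzPolyhedral.surf_frontier_lt_top {O : Set (E d)}
    (hO : IsLipschitzPolyhedral O) : surf d (frontier O) < ⊤ := by
  obtain ⟨C, hC⟩ := exists_trace_bound hO ℝ
  have h := hC (fun _ => 1) contDiff_const
  have hv : volume O < ⊤ := hO.isBounded.measure_lt_top
  have : IsFiniteMeasure ((volume : Measure (E d)).restrict O) := ⟨by simpa using hv⟩
  have h1 : eLpNorm (fun _ : E d => (1 : ℝ)) 2 (volume.restrict O) < ⊤ := (memLp_const 1).2
  have h2 : eLpNorm (fun _ : E d => (1 : ℝ)) 2 ((surf d).restrict (frontier O)) < ⊤ := by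
    refine h.trans_lt ?_
    simp only [fderiv_fun_const, Pi.zero_apply, _root_.zero_apply, eLpNorm_zero',
      Finset.sum_const_zero, add_zero]
    exact ENNReal.mul_lt_top (by simp) h1
  by_contra htop
  rw [not_lt, top_le_iff] at htop
  rw [eLpNorm_const' _ (by norm_num) (by norm_num)] at h2
  simp [htop] at h2

/-! ### Normal components, flux and dual norm on the interface -/

namespace Geometry

variable (G : Geometry d)

theorem measurableSet_interface : MeasurableSet G.interface :=
  G.polyΩ.isOpen.measurableSet.inter
    (isClosed_frontier.measurableSet.inter isClosed_frontier.measurableSet)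

theorem surf_interface_lt_top : surf d G.interface < ⊤ :=
  (measure_mono fun _ hx => hx.2.1).trans_lt G.polyS.surf_frontier_lt_top

theorem normalComp_zero : G.normalComp 0 = 0 := by simpa using G.normalComp_smul 0 0

theorem norm_normalComp_le (g : L2Surf (frontier G.ΩS) (E d)) : ‖G.normalComp g‖ ≤ ‖g‖ := by
  rw [normalComp, Lp.norm_toLp, Lp.norm_def]
  refine ENNReal.toReal_mono (Lp.memLp g).2.ne ?_
  refine (eLpNorm_mono fun x => ?_).trans
    (eLpNorm_mono_measure g (Measure.restrict_mono (fun _ hx => hx.2.1) le_rfl))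
  calc ‖⟪g x, G.normal x⟫‖ ≤ ‖g x‖ * ‖G.normal x‖ := norm_inner_le_norm _ _
    _ ≤ ‖g x‖ * 1 := by gcongr; exact norm_outerNormal_le _ _
    _ = ‖g x‖ := mul_one _

/-- The flux through the interface is an `L²(Σ)` inner product with a constant. -/
theorem exists_integral_interface_eq_inner :
    ∃ c : G.L2I, ∀ f : G.L2I, ∫ x in G.interface, f x ∂(surf d) = ⟪c, f⟫ := by
  have hfin : (surf d).restrict G.interface Set.univ ≠ ⊤ := by
    simpa using G.surf_interface_lt_top.ne
  refine ⟨indicatorConstLp 2 MeasurableSet.univ hfin (1 : ℝ), fun f => ?_⟩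
  rw [L2.inner_indicatorConstLp_one, setIntegral_univ]

theorem flux_eq {u : L2 G.ΩS (E d)} {g : L2Surf (frontier G.ΩS) (E d)}
    (h : HasTrace G.ΩS u g) :
    G.flux u = ∫ x in G.interface, G.normalComp g x ∂(surf d) := by
  rw [flux, trace_eq G.polyS h]

theorem flux_neg {u : L2 G.ΩS (E d)} {g : L2Surf (frontier G.ΩS) (E d)}
    (h : HasTrace G.ΩS u g) : G.flux (-u) = -G.flux u := by
  obtain ⟨c, hc⟩ := G.exists_integral_interface_eq_inner
  have h' := h.smul (-1)
  rw [neg_one_smul] at h'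
  rw [G.flux_eq h', G.flux_eq h, hc, hc, G.normalComp_smul, neg_one_smul, inner_neg_right]

theorem flux_eq_zero {u : L2 G.ΩS (E d)} (h : HasTrace G.ΩS u 0) : G.flux u = 0 := by
  obtain ⟨c, hc⟩ := G.exists_integral_interface_eq_inner
  rw [G.flux_eq h, hc, G.normalComp_zero, inner_zero_right]

theorem exists_norm_normalComp_le : ∃ C > 0, ∀ u g, HasTrace G.ΩS u g →
    ‖G.normalComp g‖ ≤ C * h1Norm u := by
  obtain ⟨C, hC0, hC⟩ := exists_norm_trace_le G.polyS (E d)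
  exact ⟨C, hC0, fun u g h => (G.norm_normalComp_le g).trans (hC u g h)⟩

theorem exists_abs_flux_le : ∃ C ≥ 0, ∀ u g, HasTrace G.ΩS u g → |G.flux u| ≤ C * h1Norm u := by
  obtain ⟨c, hc⟩ := G.exists_integral_interface_eq_inner
  obtain ⟨C, hC0, hC⟩ := G.exists_norm_normalComp_le
  refine ⟨‖c‖ * C, by positivity, fun u g h => ?_⟩
  rw [G.flux_eq h, hc, mul_assoc]
  exact (abs_real_inner_le_norm _ _).trans (by gcongr; exact hC u g h)

theorem ExtendsToH1.norm_le {C : ℝ}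
    (hC : ∀ (w : L2 G.ΩD ℝ) (g : L2Surf (frontier G.ΩD) ℝ), HasTrace G.ΩD w g →
      ‖g‖ ≤ C * h1Norm w) {ψ : G.L2I} {w : L2 G.ΩD ℝ} (h : G.ExtendsToH1 ψ w) :
    ‖ψ‖ ≤ C * h1Norm w := by
  obtain ⟨g, hg, hψ⟩ := h
  refine le_trans ?_ (hC w g hg)
  have hsub : (surf d).restrict G.interface ≤ (surf d).restrict (frontier G.ΩD) :=
    Measure.restrict_mono (fun _ hx => hx.2.2) le_rfl
  rw [Lp.norm_def, Lp.norm_def]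
  refine ENNReal.toReal_mono (Lp.memLp g).2.ne ?_
  have e : ψ =ᵐ[(surf d).restrict G.interface] g := by
    filter_upwards [ae_mono hsub hψ, ae_restrict_mem G.measurableSet_interface] with x hx hx'
    rw [hx, Set.indicator_of_mem hx']
  rw [eLpNorm_congr_ae e]
  exact eLpNorm_mono_measure g hsub

/-- `L²(Σ)` is continuously embedded in `H^{-1/2}_{00}(Σ)`. -/
theorem exists_h00DualNorm_le : ∃ C > 0, ∀ φ : G.L2I, G.h00DualNorm φ ≤ C * ‖φ‖ := by
  obtain ⟨C, hC0, hC⟩ := exists_norm_trace_le G.polyD ℝ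
  refine ⟨C, hC0, fun φ => Real.sSup_le ?_ (by positivity)⟩
  rintro _ ⟨ψ, ⟨w, hw⟩, hψ, rfl⟩
  -- The extension `w` shows that the infimum is over a nonempty set, so the default value of `sInf`
  -- does not interfere; every competitor has norm at least ‖ψ‖/C by the trace inequality.
  have h1 : ‖ψ‖ / C ≤ G.h00Norm ψ := by
    refine le_csInf ⟨_, w, hw, rfl⟩ ?_
    rintro _ ⟨w', hw', rfl⟩
    rw [div_le_iff₀' hC0]
    exact ExtendsToH1.norm_le G hC hw'
  have h2 : ‖ψ‖ ≤ C := by simpa using (div_le_iff₀' hC0).mp (h1.trans hψ)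
  calc |⟪φ, ψ⟫| ≤ ‖φ‖ * ‖ψ‖ := abs_real_inner_le_norm _ _
    _ ≤ ‖φ‖ * C := by gcongr
    _ = C * ‖φ‖ := mul_comm _ _

/-! ### Fields and functions with zero normal trace -/

/-- The elements of `L²(Σ)` which annihilate the traces of functions vanishing on `Γ_D`. -/
def zeroNormalTraces : Submodule ℝ G.L2I where
  carrier := {φ | G.HasNormalTrace 0 φ}
  zero_mem' := HasNormalTrace.zero G
  add_mem' := fun h h' => by
    simpa using HasNormalTrace.add G (Hdiv G.ΩD).zero_mem (Hdiv G.ΩD).zero_mem h h'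
  smul_mem' := fun c _ h => by
    simpa using HasNormalTrace.smul G c (Hdiv G.ΩD).zero_mem h

/-- Each test function imposes one condition, an L²(Σ) inner product with its trace equal to a
constant, so the set is an intersection of closed sets. -/
theorem isClosed_zeroNormalTraces : IsClosed (G.zeroNormalTraces : Set G.L2I) := by
  have e : (G.zeroNormalTraces : Set G.L2I) =
      ⋂ (w : L2 G.ΩD ℝ) (g : L2Surf (frontier G.ΩD) ℝ) (_ : HasTrace G.ΩD w g)
        (_ : VanishesOn g G.ΓD),
        {φ | - normalPairing G.ΩD 0 w = ∫ x in G.interface, φ x * g x ∂(surf d)} := by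
    ext φ
    simp only [Set.mem_iInter]
    rfl
  rw [e]
  refine isClosed_iInter fun w => isClosed_iInter fun g => isClosed_iInter fun _ =>
    isClosed_iInter fun _ => isClosed_eq continuous_const ?_
  have hg : MemLp g 2 ((surf d).restrict G.interface) :=
    (Lp.memLp g).mono_measure (Measure.restrict_mono (fun _ hx => hx.2.2) le_rfl)
  have : (fun φ : G.L2I => ∫ x in G.interface, φ x * g x ∂(surf d))
      = fun φ => ⟪hg.toLp, φ⟫ := by
    funext φ
    rw [L2.inner_def]
    refine integral_congr_ae ?_
    filter_upwards [hg.coeFn_toLp] with x hx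
    rw [hx]
    simp
  rw [this]
  fun_prop

theorem hasNormalTrace_zero_of_mem_Hdiv0 {u : L2 G.ΩD (E d)} (hu : u ∈ G.Hdiv0) :
    G.HasNormalTrace u 0 := by
  intro w g hw _
  rw [hu.2 w ⟨g, hw, Eventually.of_forall fun x hx => hx.elim⟩, neg_zero, eq_comm,
    ← integral_zero (E d) ℝ (μ := (surf d).restrict G.interface)]
  refine integral_congr_ae ?_
  filter_upwards [Lp.coeFn_zero ℝ 2 ((surf d).restrict G.interface)] with x hx
  simp only [hx, Pi.zero_apply, zero_mul]

/-- A field in H_0(div) is tested against every w with a trace, since vanishing on the empty set is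
no restriction. -/
theorem Hdiv0_le_HdivD : G.Hdiv0 ≤ G.HdivD := fun _ hu => ⟨hu.1, fun w ⟨g, hg, _⟩ =>
  hu.2 w ⟨g, hg, Eventually.of_forall fun _ hx => hx.elim⟩⟩

theorem H10_le_H1S : G.H10 ≤ G.H1S := fun _ ⟨g, hg, hg'⟩ =>
  ⟨g, hg, hg'.mono fun _ hx hx' => hx hx'.1⟩

/-! ### The product norms -/

theorem velNorm_nonneg (u : G.VelPair) : 0 ≤ G.velNorm u := Real.sqrt_nonneg _

theorem h1Norm_le_velNorm (u : G.VelPair) : h1Norm u.1 ≤ G.velNorm u :=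
  Real.le_sqrt_of_sq_le (le_add_of_nonneg_right (by positivity))

theorem hdivNorm_le_velNorm (u : G.VelPair) : hdivNorm u.2 ≤ G.velNorm u :=
  Real.le_sqrt_of_sq_le (le_add_of_nonneg_left (by positivity))

theorem velNorm_le (u : G.VelPair) : G.velNorm u ≤ h1Norm u.1 + hdivNorm u.2 :=
  Real.sqrt_le_iff.mpr ⟨add_nonneg (h1Norm_nonneg _) (hdivNorm_nonneg _), by
    nlinarith [h1Norm_nonneg u.1, hdivNorm_nonneg u.2]⟩

theorem velNorm_pos {u : G.VelPair} (hu : u ≠ 0) : 0 < G.velNorm u := by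
  by_contra h
  have h0 := not_lt.mp h
  refine hu (Prod.ext ?_ ?_)
  · exact norm_le_zero_iff.mp
      (((norm_le_h1Norm u.1).trans (G.h1Norm_le_velNorm u)).trans h0)
  · exact norm_le_zero_iff.mp
      (((norm_le_hdivNorm u.2).trans (G.hdivNorm_le_velNorm u)).trans h0)

theorem pressNorm_le (q : G.PressTriple) : G.pressNorm q ≤ ‖q.1.1‖ + ‖q.1.2‖ + |q.2| :=
  Real.sqrt_le_iff.mpr ⟨by positivity, by
    nlinarith [norm_nonneg q.1.1, norm_nonneg q.1.2, abs_nonneg q.2, sq_abs q.2,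
      mul_nonneg (norm_nonneg q.1.1) (norm_nonneg q.1.2),
      mul_nonneg (norm_nonneg q.1.1) (abs_nonneg q.2),
      mul_nonneg (norm_nonneg q.1.2) (abs_nonneg q.2)]⟩

end Geometry

/-! ## Suprema of quotients -/

/-- A real supremum is 0 for an empty or unbounded set, so the bound `M` is required before the
supremum says anything about individual elements. Oddness of `ℓ` gives the absolute value and, with
it, nonnegativity of the supremum. -/
theorem mul_le_iSup_div {X : Type*} [AddCommGroup X] [Module ℝ X] {S : Submodule ℝ X}
    {ℓ N : X → ℝ} {M : ℝ} (hN0 : ∀ s, 0 ≤ N s)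
    (hN : ∀ s ∈ S, s ≠ 0 → 0 < N s) (hNneg : ∀ s ∈ S, N (-s) = N s)
    (hℓneg : ∀ s ∈ S, ℓ (-s) = -ℓ s) (hM : ∀ s ∈ S, |ℓ s| ≤ M * N s) :
    0 ≤ (⨆ s : {s : X // s ∈ S ∧ s ≠ 0}, ℓ s / N s) ∧
      ∀ s ∈ S, |ℓ s| ≤ (⨆ s : {s : X // s ∈ S ∧ s ≠ 0}, ℓ s / N s) * N s := by
  have hbdd : BddAbove (Set.range fun s : {s : X // s ∈ S ∧ s ≠ 0} => ℓ s / N s) := by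
    refine ⟨M, ?_⟩
    rintro _ ⟨⟨s, hs, hs0⟩, rfl⟩
    exact (div_le_iff₀ (hN s hs hs0)).mpr ((le_abs_self _).trans (hM s hs))
  have hle : ∀ s ∈ S, s ≠ 0 →
      ℓ s ≤ (⨆ s : {s : X // s ∈ S ∧ s ≠ 0}, ℓ s / N s) * N s := fun s hs hs0 =>
    (div_le_iff₀ (hN s hs hs0)).mp (le_ciSup hbdd ⟨s, hs, hs0⟩)
  have habs : ∀ s ∈ S, s ≠ 0 →
      |ℓ s| ≤ (⨆ s : {s : X // s ∈ S ∧ s ≠ 0}, ℓ s / N s) * N s := fun s hs hs0 => by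
    have h := hle (-s) (S.neg_mem hs) (neg_ne_zero.mpr hs0)
    rw [hℓneg s hs, hNneg s hs] at h
    exact abs_le.mpr ⟨by linarith, hle s hs hs0⟩
  have hnonneg : 0 ≤ ⨆ s : {s : X // s ∈ S ∧ s ≠ 0}, ℓ s / N s := by
    rcases isEmpty_or_nonempty {s : X // s ∈ S ∧ s ≠ 0} with h | ⟨⟨s, hs, hs0⟩⟩
    · rw [Real.iSup_of_isEmpty]
    · exact nonneg_of_mul_nonneg_left ((abs_nonneg _).trans (habs s hs hs0)) (hN s hs hs0)
  refine ⟨hnonneg, fun s hs => ?_⟩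
  by_cases hs0 : s = 0
  · have h0 : ℓ s = 0 := by
      have := hℓneg s hs
      rw [hs0, neg_zero] at this
      rw [hs0]
      linarith
    rw [h0, abs_zero]
    exact mul_nonneg hnonneg (hN0 s)
  · exact habs s hs hs0

theorem iSup_div_le {X : Type*} [AddCommGroup X] [Module ℝ X] {S : Submodule ℝ X}
    {ℓ N : X → ℝ} {σ : ℝ} (hN : ∀ s, 0 ≤ N s) (hσ : 0 ≤ σ) (h : ∀ s ∈ S, ℓ s ≤ σ * N s) :
    (⨆ s : {s : X // s ∈ S ∧ s ≠ 0}, ℓ s / N s) ≤ σ :=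
  Real.iSup_le (fun s => div_le_of_le_mul₀ (hN _) hσ (h s s.2.1)) hσ

/-! ### The projection onto the discrete normal traces and elements of 𝕏^h -/

namespace Discretization

variable {G : Geometry d} {ι : Type*} (D : Discretization G ι)

/-- Elements killed by the lifting are normal traces of the zero field. A complement of its kernel
embeds in the finite dimensional space H^h_D(Ω_D). Hence Φ^h_D is the sum of the closed space
`zeroNormalTraces` and a finite dimensional one. -/
theorem HasStableLifting.isClosed_ΦD {D : Discretization G ι} (hL : D.HasStableLifting) (h : ι) :
    IsClosed (D.ΦD h : Set G.L2I) := by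
  obtain ⟨C, -, hL⟩ := hL
  obtain ⟨L, hL⟩ := hL h
  obtain ⟨S, hS⟩ := (LinearMap.ker L).exists_isCompl
  have : FiniteDimensional ℝ (D.HD h) := D.finHD h
  have : FiniteDimensional ℝ (D.HDD h) := Submodule.finiteDimensional_of_le inf_le_left
  have : FiniteDimensional ℝ S := by
    refine FiniteDimensional.of_injective (L.domRestrict S) ?_
    rw [← LinearMap.ker_eq_bot, LinearMap.ker_domRestrict]
    exact (Submodule.disjoint_iff_comap_eq_bot).mp hS.disjoint.symm
  have e : D.ΦD h = G.zeroNormalTraces ⊔ S.map (D.ΦD h).subtype := by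
    refine le_antisymm (fun φ hφ => ?_) (sup_le (fun φ hφ => ?_) ?_)
    · have hmem : (⟨φ, hφ⟩ : D.ΦD h) ∈ LinearMap.ker L ⊔ S := by
        rw [hS.sup_eq_top]
        trivial
      obtain ⟨k, hk, s, hs, hks⟩ := Submodule.mem_sup.mp hmem
      refine Submodule.mem_sup.mpr ⟨k, ?_, s, ⟨s, hs, rfl⟩, congrArg Subtype.val hks⟩
      have h1 := (hL k).1
      rw [LinearMap.mem_ker.mp hk] at h1
      exact h1
    · exact ⟨0, (D.HDD h).zero_mem, hφ⟩
    · rintro _ ⟨s, _, rfl⟩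
      exact s.2
  rw [e]
  exact Submodule.isClosed_sup_finiteDimensional _ _ G.isClosed_zeroNormalTraces

theorem HasStableLifting.exists_isProjΦD {D : Discretization G ι} (hL : D.HasStableLifting)
    (h : ι) (f : G.L2I) : ∃ r, D.IsProjΦD h f r := by
  have := (hL.isClosed_ΦD h).completeSpace_coe
  refine ⟨(D.ΦD h).starProjection f, Submodule.starProjection_apply_mem _ _, fun φ hφ => ?_⟩
  exact Submodule.starProjection_inner_eq_zero f φ hφ

/-- Testing the orthogonality with r itself gives ‖r‖² = ⟨f, r⟩, and Cauchy–Schwarz concludes. -/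
theorem IsProjΦD.norm_le {D : Discretization G ι} {h : ι} {f r : G.L2I}
    (hr : D.IsProjΦD h f r) : ‖r‖ ≤ ‖f‖ := by
  have h1 := hr.2 r hr.1
  rw [inner_sub_left, real_inner_self_eq_norm_sq] at h1
  have h2 := real_inner_le_norm f r
  by_contra hlt
  nlinarith [norm_nonneg f, norm_nonneg r]

/-- Extension of the discrete fields of the second hypothesis to elements of `𝕏^h`. -/
theorem Hypothesis2.exists_mem_Xh {D : Discretization G ι} (h2 : D.Hypothesis2) :
    ∃ β₀ > 0, ∃ M ≥ 0, ∀ h, ∃ z ∈ D.Xh h, β₀ ≤ G.flux z.1 ∧ G.velNorm z ≤ M := by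
  obtain ⟨β₀, hβ₀, β₁, hβ₁, hv⟩ := h2.permeability
  obtain ⟨C, hC0, hL⟩ := id h2.lifting
  obtain ⟨C₁, hC₁0, hC₁⟩ := G.exists_h00DualNorm_le
  obtain ⟨C₂, hC₂0, hC₂⟩ := G.exists_norm_normalComp_le
  -- The second summand bounds the lifted field: `C` from the lifting, `C₁` from L²(Σ) into the dual
  -- norm, `C₂` from the trace inequality for v.
  refine ⟨β₀, hβ₀, β₁ + C * (C₁ * (C₂ * β₁)), by positivity, fun h => ?_⟩
  obtain ⟨v, hvS, hflux, hvn⟩ := hv h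
  obtain ⟨L, hL⟩ := hL h
  obtain ⟨g, hg, -⟩ := id hvS.2
  obtain ⟨r, hr⟩ := h2.lifting.exists_isProjΦD h (G.normalComp g)
  obtain ⟨hLr, hLn⟩ := hL ⟨r, hr.1⟩
  refine ⟨(v, L ⟨r, hr.1⟩), ⟨hvS, (L ⟨r, hr.1⟩).2, g, r, hg, hr, hLr⟩, hflux,
    (G.velNorm_le _).trans (add_le_add hvn (hLn.trans ?_))⟩
  gcongr
  refine (hC₁ r).trans ?_
  gcongr
  refine hr.norm_le.trans ((hC₂ v g hg).trans ?_)
  gcongr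

theorem inl_mem_Xh {h : ι} {u : L2 G.ΩS (E d)} (hu : u ∈ D.HS0 h) :
    ((u, 0) : G.VelPair) ∈ D.Xh h ∧ HasTrace G.ΩS u 0 := by
  obtain ⟨g, hg, hg0⟩ := id hu.2
  rw [hg0.eq_zero] at hg
  refine ⟨⟨⟨hu.1, G.H10_le_H1S hu.2⟩, (D.HDD h).zero_mem, 0, 0, hg,
    ⟨(D.ΦD h).zero_mem, fun φ _ => ?_⟩, Geometry.HasNormalTrace.zero G⟩, hg⟩
  rw [G.normalComp_zero, sub_zero, inner_zero_left]

theorem inr_mem_Xh {h : ι} {u : L2 G.ΩD (E d)} (hu : u ∈ D.HD0 h) :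
    ((0, u) : G.VelPair) ∈ D.Xh h := by
  refine ⟨(D.HSS h).zero_mem, ⟨hu.1, G.Hdiv0_le_HdivD hu.2⟩, 0, 0, HasTrace.zero,
    ⟨(D.ΦD h).zero_mem, fun φ _ => ?_⟩, G.hasNormalTrace_zero_of_mem_Hdiv0 hu.2⟩
  rw [G.normalComp_zero, sub_zero, inner_zero_left]

/-! ### Oddness and boundedness of b on 𝕏^h -/

variable {D}

theorem H1_of_mem_Xh {h : ι} {u : G.VelPair} (hu : u ∈ D.Xh h) : u.1 ∈ H1 G.ΩS (E d) :=
  D.HS_le h hu.1.1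

theorem Hdiv_of_mem_Xh {h : ι} {u : G.VelPair} (hu : u ∈ D.Xh h) : u.2 ∈ Hdiv G.ΩD :=
  D.HD_le h hu.2.1.1

theorem velNorm_neg {h : ι} {u : G.VelPair} (hu : u ∈ D.Xh h) :
    G.velNorm (-u) = G.velNorm u := by
  rw [Geometry.velNorm, Geometry.velNorm, Prod.fst_neg, Prod.snd_neg,
    h1Norm_neg G.polyS.isOpen (H1_of_mem_Xh hu), hdivNorm_neg G.polyD.isOpen (Hdiv_of_mem_Xh hu)]

theorem b_neg {h : ι} {u : G.VelPair} (hu : u ∈ D.Xh h) (q : G.PressTriple) :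
    G.b (-u) q = -G.b u q := by
  obtain ⟨g, r, hg, -⟩ := id hu.2.2
  rw [Geometry.b, Geometry.b, Prod.fst_neg, Prod.snd_neg,
    weakDiv_neg G.polyS.isOpen (H1_le_Hdiv _ (H1_of_mem_Xh hu)),
    weakDiv_neg G.polyD.isOpen (Hdiv_of_mem_Xh hu), G.flux_neg hg, inner_neg_left, inner_neg_left]
  ring

theorem abs_inner_weakDiv_le_left {h : ι} {u : G.VelPair} (hu : u ∈ D.Xh h) (q : L2 G.ΩS ℝ) :
    |⟪weakDiv G.ΩS u.1, q⟫| ≤ d * G.velNorm u * ‖q‖ := by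
  refine (abs_real_inner_le_norm _ _).trans ?_
  gcongr
  refine (norm_weakDiv_le_h1Norm G.polyS.isOpen (H1_of_mem_Xh hu)).trans ?_
  gcongr
  exact G.h1Norm_le_velNorm u

theorem abs_inner_weakDiv_le_right (u : G.VelPair) (q : L2 G.ΩD ℝ) :
    |⟪weakDiv G.ΩD u.2, q⟫| ≤ G.velNorm u * ‖q‖ := by
  refine (abs_real_inner_le_norm _ _).trans ?_
  gcongr
  exact (norm_weakDiv_le_hdivNorm _).trans (G.hdivNorm_le_velNorm u)

/-- The constant may depend on q: it only ensures that the supremum defining the inf-sup quotient is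
finite. -/
theorem exists_abs_b_le (q : G.PressTriple) :
    ∃ M, ∀ h, ∀ u ∈ D.Xh h, |G.b u q| ≤ M * G.velNorm u := by
  obtain ⟨C, hC0, hC⟩ := G.exists_abs_flux_le
  refine ⟨d * ‖q.1.1‖ + ‖q.1.2‖ + |q.2| * C, fun h u hu => ?_⟩
  obtain ⟨g, r, hg, -⟩ := id hu.2.2
  have h3 : |q.2 * G.flux u.1| ≤ |q.2| * (C * G.velNorm u) := by
    rw [abs_mul]
    gcongr
    refine (hC _ _ hg).trans ?_
    gcongr
    exact G.h1Norm_le_velNorm u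
  rw [Geometry.b]
  refine (abs_add_three _ _ _).trans ?_
  linarith [abs_inner_weakDiv_le_left hu q.1.1, abs_inner_weakDiv_le_right u q.1.2]

end Discretization

end StokesDarcy

end

/-! ### The uniform inf-sup condition -/

open StokesDarcy Discretization in
theorem mainTheorem3 {d : ℕ} (hd : d = 2 ∨ d = 3) (G : StokesDarcy.Geometry d) {ι : Type*}
    (D : StokesDarcy.Discretization G ι) (h1 : D.Hypothesis1) (h2 : D.Hypothesis2) :
    StokesDarcy.UniformInfSup D.Xh D.Qh G.velNorm G.pressNorm G.b := by
  obtain ⟨βS, hβS, hS⟩ := h1.stokes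
  obtain ⟨βD, hβD, hD⟩ := h1.darcy
  obtain ⟨β₀, hβ₀, M, hM, hz⟩ := h2.exists_mem_Xh
  -- The three summands are the multiples of σ that bound ‖q_S‖, ‖q_D‖ and |δ|.
  set B : ℝ := βS⁻¹ + βD⁻¹ + β₀⁻¹ * (M + d * M * βS⁻¹ + M * βD⁻¹) with hB
  have hB0 : 0 < B := by positivity
  refine ⟨B⁻¹, by positivity, fun h t ht => ?_⟩
  obtain ⟨C, hC⟩ := exists_abs_b_le (D := D) t
  obtain ⟨hσ, hle⟩ := mul_le_iSup_div (S := D.Xh h) (ℓ := fun s => G.b s t) (N := G.velNorm)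
    G.velNorm_nonneg (fun s _ hs0 => G.velNorm_pos hs0) (fun s hs => velNorm_neg hs)
    (fun s hs => b_neg hs t) (hC h)
  set σ : ℝ := ⨆ s : {s : G.VelPair // s ∈ D.Xh h ∧ s ≠ 0}, G.b s t / G.velNorm s
  have hqS : ‖t.1.1‖ ≤ βS⁻¹ * σ := by
    rw [inv_mul_eq_div, le_div_iff₀' hβS]
    refine (hS h _ ht.1.1).trans (iSup_div_le
      (ℓ := fun u => ⟪weakDiv G.ΩS u, t.1.1⟫) h1Norm_nonneg hσ fun u hu => ?_)
    -- On the pair (u, 0) the flux term vanishes and the norm of 𝕏 is the H¹ norm of u, so the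
    -- Stokes quotient is one of those bounded by σ.
    obtain ⟨hX, htr⟩ := D.inl_mem_Xh hu
    have h3 := (le_abs_self _).trans (hle _ hX)
    simpa [Geometry.b, Geometry.velNorm, weakDiv_zero G.polyD.isOpen, G.flux_eq_zero htr,
      hdivNorm_zero G.polyD.isOpen, Real.sqrt_sq (h1Norm_nonneg u)] using h3
  have hqD : ‖t.1.2‖ ≤ βD⁻¹ * σ := by
    rw [inv_mul_eq_div, le_div_iff₀' hβD]
    refine (hD h _ ht.1.2).trans (iSup_div_le
      (ℓ := fun u => ⟪weakDiv G.ΩD u, t.1.2⟫) hdivNorm_nonneg hσ fun u hu => ?_)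
    have h3 := (le_abs_self _).trans (hle _ (D.inr_mem_Xh hu))
    simpa [Geometry.b, Geometry.velNorm, weakDiv_zero G.polyS.isOpen,
      G.flux_eq_zero HasTrace.zero, h1Norm_zero G.polyS.isOpen,
      Real.sqrt_sq (hdivNorm_nonneg u)] using h3
  have hδ : |t.2| ≤ β₀⁻¹ * (M + d * M * βS⁻¹ + M * βD⁻¹) * σ := by
    obtain ⟨z, hzX, hzf, hzn⟩ := hz h
    -- The flux term is isolated; the pressures appearing in the divergence terms are already
    -- bounded by σ.
    have e : t.2 * G.flux z.1 =
        G.b z t - ⟪weakDiv G.ΩS z.1, t.1.1⟫ - ⟪weakDiv G.ΩD z.2, t.1.2⟫ := by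
      rw [Geometry.b]
      ring
    have hup : |t.2 * G.flux z.1| ≤ σ * M + d * M * (βS⁻¹ * σ) + M * (βD⁻¹ * σ) := by
      rw [e]
      refine (abs_sub _ _).trans (add_le_add ((abs_sub _ _).trans (add_le_add ?_ ?_)) ?_)
      · exact (hle z hzX).trans (by gcongr)
      · refine (abs_inner_weakDiv_le_left hzX _).trans ?_
        gcongr
      · refine (abs_inner_weakDiv_le_right z _).trans ?_
        gcongr
    have hlow : |t.2| * β₀ ≤ |t.2 * G.flux z.1| := by
      rw [abs_mul]
      gcongr
      exact hzf.trans (le_abs_self _)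
    rw [mul_assoc, inv_mul_eq_div, le_div_iff₀ hβ₀]
    linarith
  rw [inv_mul_le_iff₀ hB0]
  refine (G.pressNorm_le t).trans ?_
  rw [hB, add_mul, add_mul]
  linarith
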